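/- **Theorem 2.2.** Let $g,k,\mu>0$ and $0<\rho_-<\rho_+$. Let $\rho_0:\mathbb R\to\mathbb R$ be of class $C^1$ with $\rho_0'\ge 0$ and $\operatorname{supp}\rho_0'=[-a,a]$, and suppose $\rho_0(x)=\rho_-$ for $x\le -a$ and $\rho_0(x)=\rho_+$ for $x\ge a$. Define $L_0>0$ by $L_0^{-1}=\sup_{x\in\mathbb R}\rho_0'(x)/\rho_0(x)$. Then there is an infinite sequence $(\lambda_n,\phi_n)_{n\ge 1}$ such that, for every $n$, $\lambda_n\in\big(0,\sqrt{g/L_0}\big)$, $\phi_n\in H^4(\mathbb R)$ is real-valued and not identically zero (as an element of $L^2(\mathbb R)$), and $(\lambda,\phi)=(\lambda_n,\phi_n)$ satisfies $$-\lambda^2\big(\rho_0k^2\phi-(\rho_0\phi')'\big)=\lambda\mu\big(\phi^{(4)}-2k^2\phi''+k^4\phi\big)-gk^2\rho_0'\phi$$ almost everywhere on $\mathbb R$, the derivatives of $\phi$ and $\rho_0\phi'$ being weak derivatives. Moreover, the sequence $(\lambda_n)$ is strictly decreasing and $\lambda_n\to 0$ as $n\to\infty$. -/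

import Mathlib

open MeasureTheory Filter Topology Set
open scoped ContDiff

/-- `g` is a weak (distributional) derivative of `f` on the real line: both are locally
integrable, and `∫ f η' = - ∫ g η` for every test function `η`. -/
def IsWeakDeriv (f g : ℝ → ℝ) : Prop :=
  LocallyIntegrable f volume ∧ LocallyIntegrable g volume ∧
    ∀ η : ℝ → ℝ, ContDiff ℝ ∞ η → HasCompactSupport η →
      ∫ x, f x * deriv η x = - ∫ x, g x * η x

/-- The Sobolev space `H^m(ℝ)` of real functions: `φ` and its successive weak derivatives
`d 0 = φ, d 1, …, d m` all lie in `L²(ℝ)`. -/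
def MemSobolevH (m : ℕ) (φ : ℝ → ℝ) : Prop :=
  ∃ d : ℕ → ℝ → ℝ, d 0 = φ ∧ (∀ j < m, IsWeakDeriv (d j) (d (j + 1))) ∧
    ∀ j ≤ m, MemLp (d j) 2 volume

/-- `φ` satisfies, almost everywhere and with weak derivatives,
`-lam² (ρ k² φ - (ρ φ')') = lam μ (φ'''' - 2 k² φ'' + k⁴ φ) - g k² ρ' φ`.
Weak derivatives are unique up to null sets, so the choice of `φ₁, …, φ₄, w` is immaterial. -/
def SolvesRayleighTaylorODE (g k μ : ℝ) (ρ : ℝ → ℝ) (lam : ℝ) (φ : ℝ → ℝ) : Prop :=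
  ∃ φ₁ φ₂ φ₃ φ₄ w : ℝ → ℝ,
    IsWeakDeriv φ φ₁ ∧ IsWeakDeriv φ₁ φ₂ ∧ IsWeakDeriv φ₂ φ₃ ∧ IsWeakDeriv φ₃ φ₄ ∧
    IsWeakDeriv (fun x => ρ x * φ₁ x) w ∧
    ∀ᵐ x ∂(volume : Measure ℝ),
      - lam ^ 2 * (ρ x * k ^ 2 * φ x - w x) =
        lam * μ * (φ₄ x - 2 * k ^ 2 * φ₂ x + k ^ 4 * φ x) - g * k ^ 2 * deriv ρ x * φ x

/-- The characteristic length `L₀` of the density profile, given by `1 / L₀ = sup (ρ' / ρ)`. -/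
noncomputable def charLength (ρ : ℝ → ℝ) : ℝ := (⨆ x : ℝ, deriv ρ x / ρ x)⁻¹

/-! Write `φ = R v` with `R = (k² - d²/dx²)⁻¹`. Applying `R` to the equation turns it into a
quadratic pencil on `L²`, `t μ v + t² P v = ι* ι v`. Here `P = inertiaOp` is bounded, symmetric and
nonnegative. The operator `ι = s R` with `s² = g k² ρ'` is compact, because `s` has compact support
(Rellich).

The left side is a coercive operator `A(t)`, so a solution exists as soon as `1` is an eigenvalue of
the compact nonnegative operator `J(t) = ι A(t)⁻¹ ι*`. Count the dimension on which the form of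
`J(t) - 1` is positive. While `1` is not an eigenvalue there is a spectral gap at `1`
(`exists_spectral_gap_at_one`), and this index is finite and locally constant
(`hasPosSubspace_iff_of_gap`). As `t → 0` it exceeds every `n`, since `A(t)⁻¹` grows like `1/t` and
`ι*` is injective on spaces of any finite dimension. By connectedness every interval `(0, ε)`
contains an eigenvalue parameter (`exists_small_pencil_eigenvalue`). Only continuity of `J` is used,
not monotonicity in `t`.

The pencil equation itself gives `v` two weak derivatives, hence `φ ∈ H⁴`
(`memSobolevH_and_solves_of_pencil`). Pairing it with `v` bounds `t` (`sq_lt_of_pencil`). -/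

/-! ### Spectral gaps and stability of the positive index. -/

section PositiveIndex

open scoped InnerProductSpace

variable {Y : Type*} [NormedAddCommGroup Y] [InnerProductSpace ℝ Y]

/-- The quadratic form of `T - 1` is positive definite on some subspace of dimension
at least `n`. -/
def HasPosSubspace (T : Y →L[ℝ] Y) (n : ℕ) : Prop :=
  ∃ V : Submodule ℝ Y, FiniteDimensional ℝ V ∧ n ≤ Module.finrank ℝ V ∧
    ∀ y ∈ V, y ≠ 0 → ‖y‖ ^ 2 < ⟪T y, y⟫_ℝ

theorem abs_inner_sub_le (S T : Y →L[ℝ] Y) (y : Y) :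
    |⟪S y, y⟫_ℝ - ⟪T y, y⟫_ℝ| ≤ ‖S - T‖ * ‖y‖ ^ 2 := by
  rw [← inner_sub_left, ← sub_apply]
  refine (abs_real_inner_le_norm _ _).trans ?_
  rw [pow_two, ← mul_assoc]
  gcongr
  exact ContinuousLinearMap.le_opNorm _ _

/-- A perturbation smaller than the gap keeps the form of `S - 1` positive on `E` and nonpositive on
`Eᗮ`. A positive subspace for `S` therefore meets `Eᗮ` trivially, so it projects injectively to `E`.
-/
theorem hasPosSubspace_iff_of_gap {S T : Y →L[ℝ] Y} {E : Submodule ℝ Y} [FiniteDimensional ℝ E]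
    {c : ℝ} (hE : ∀ y ∈ E, (1 + c) * ‖y‖ ^ 2 ≤ ⟪T y, y⟫_ℝ)
    (hF : ∀ y ∈ Eᗮ, ⟪T y, y⟫_ℝ ≤ (1 - c) * ‖y‖ ^ 2) (hST : ‖S - T‖ < c) (n : ℕ) :
    HasPosSubspace S n ↔ n ≤ Module.finrank ℝ E := by
  constructor
  · rintro ⟨V, hV, hn, hpos⟩
    let P : V →ₗ[ℝ] E := (E.orthogonalProjectionOnto : Y →ₗ[ℝ] E).comp V.subtype
    refine hn.trans (LinearMap.finrank_le_finrank_of_injective (f := P) ?_)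
    rw [← LinearMap.ker_eq_bot, LinearMap.ker_eq_bot']
    rintro ⟨y, hy⟩ hPy
    have hyE : y ∈ Eᗮ := by
      rw [← Submodule.orthogonalProjectionOnto_eq_zero_iff]
      exact hPy
    by_contra hne
    have hy0 : y ≠ 0 := fun h => hne (by simp [h])
    have h1 := hpos y hy hy0
    have h2 := hF y hyE
    have h3 := (abs_le.1 (abs_inner_sub_le S T y)).2
    have h4 : ‖S - T‖ * ‖y‖ ^ 2 ≤ c * ‖y‖ ^ 2 := by gcongr
    linarith
  · intro hn
    refine ⟨E, inferInstance, hn, fun y hy hy0 => ?_⟩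
    have h1 := hE y hy
    have h3 := (abs_le.1 (abs_inner_sub_le S T y)).1
    have h4 : ‖S - T‖ * ‖y‖ ^ 2 < c * ‖y‖ ^ 2 := by
      have : 0 < ‖y‖ := norm_pos_iff.2 hy0
      gcongr
    linarith

/-- Eigenspaces of a symmetric operator are mutually orthogonal, so the form is diagonal along the
decomposition of `y`. -/
theorem le_inner_of_mem_iSup_eigenspace {T : Y →L[ℝ] Y} (hT : T.IsSymmetric) {m : ℝ} {s : Set ℝ}
    (hs : ∀ t ∈ s, Module.End.HasEigenvalue (T : Module.End ℝ Y) t → m ≤ t) {y : Y}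
    (hy : y ∈ ⨆ t : s, Module.End.eigenspace (T : Module.End ℝ Y) t) :
    m * ‖y‖ ^ 2 ≤ ⟪T y, y⟫_ℝ := by
  classical
  obtain ⟨f, hf, rfl⟩ := (Submodule.mem_iSup_iff_exists_finsupp _ y).1 hy
  have hfam : ∀ i j : s, i ≠ j → ⟪f i, f j⟫_ℝ = 0 := by
    intro i j hij
    have h := hT.orthogonalFamily_eigenspaces (fun h => hij (Subtype.ext h) : (i : ℝ) ≠ j)
    exact h ⟨f i, hf i⟩ ⟨f j, hf j⟩
  have hTf : ∀ i : s, T (f i) = (i : ℝ) • f i := fun i => Module.End.mem_eigenspace_iff.1 (hf i)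
  simp only [Finsupp.sum]
  rw [← real_inner_self_eq_norm_sq, map_sum, sum_inner, sum_inner, Finset.mul_sum]
  refine Finset.sum_le_sum fun i hi => ?_
  rw [inner_sum, inner_sum, Finset.sum_eq_single i, Finset.sum_eq_single i, hTf,
    real_inner_smul_left]
  · have hev : Module.End.HasEigenvalue (T : Module.End ℝ Y) i :=
      Module.End.hasEigenvalue_of_hasEigenvector ⟨hf i, Finsupp.mem_support_iff.1 hi⟩
    exact mul_le_mul_of_nonneg_right (hs i i.2 hev) real_inner_self_nonneg
  · intro j _ hj
    rw [hTf, real_inner_smul_left, hfam i j hj.symm, mul_zero]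
  · exact fun h => absurd hi h
  · exact fun j _ hj => hfam i j hj.symm
  · exact fun h => absurd hi h

variable [CompleteSpace Y]

/-- Coercivity makes the restriction of `T` to the closure of `E` invertible, and the restriction is
also compact. So the identity there is compact. The closure supplies the completeness that this
argument needs. -/
theorem finiteDimensional_of_norm_sq_le_inner {T : Y →L[ℝ] Y} (hT : IsCompactOperator T)
    {E : Submodule ℝ Y} (hinv : ∀ y ∈ E, T y ∈ E) (hE : ∀ y ∈ E, ‖y‖ ^ 2 ≤ ⟪T y, y⟫_ℝ) :
    FiniteDimensional ℝ E := by
  have hinv' : ∀ y ∈ E.topologicalClosure, T y ∈ E.topologicalClosure := fun y hy =>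
    map_mem_closure T.continuous hy hinv
  have hE' : ∀ y ∈ E.topologicalClosure, ‖y‖ ^ 2 ≤ ⟪T y, y⟫_ℝ := by
    have hcl : IsClosed {y : Y | ‖y‖ ^ 2 ≤ ⟪T y, y⟫_ℝ} :=
      isClosed_le (by fun_prop) (by fun_prop)
    exact fun y hy => closure_minimal hE hcl hy
  let S : E.topologicalClosure →L[ℝ] E.topologicalClosure := T.restrict hinv'
  have hS : IsCompactOperator S :=
    IsCompactOperator.restrict (f := (T : Y →ₗ[ℝ] Y)) hT hinv' E.isClosed_topologicalClosure
  have hunit : IsUnit S := by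
    refine ContinuousLinearMap.isUnit_of_forall_le_norm_inner_map S (c := 1) one_pos fun x => ?_
    have := hE' x x.2
    simp only [NNReal.coe_one, mul_one]
    exact this.trans (le_abs_self _)
  obtain ⟨u, hu⟩ := hunit
  have hid : IsCompactOperator (id : E.topologicalClosure → E.topologicalClosure) := by
    have hfun : (↑u⁻¹ : E.topologicalClosure →L[ℝ] E.topologicalClosure) ∘ S = id := by
      funext x
      have h : (↑u⁻¹ * ↑u : E.topologicalClosure →L[ℝ] E.topologicalClosure) x = x := by simp
      rwa [hu] at h
    rw [← hfun]
    exact hS.clm_comp (↑u⁻¹ : E.topologicalClosure →L[ℝ] E.topologicalClosure)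
  have := FiniteDimensional.of_isCompactOperator_id (𝕜 := ℝ) hid
  exact Submodule.finiteDimensional_of_le E.le_topologicalClosure

/-- `E` is the sum of the eigenspaces with eigenvalue above `1`. By the Fredholm alternative `T - 1`
is bounded below, which keeps those eigenvalues at least `1 + c`. The restriction of `T` to `Eᗮ` has
norm below `1`: the norm of a compact nonnegative symmetric operator, if nonzero, is an eigenvalue,
and an eigenvalue `≥ 1` on `Eᗮ` is excluded. -/
theorem exists_spectral_gap_at_one {T : Y →L[ℝ] Y} (hT : IsCompactOperator T)
    (hsymm : T.IsSymmetric) (hpos : ∀ y, 0 ≤ ⟪T y, y⟫_ℝ) (h1 : ∀ y, T y = y → y = 0) :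
    ∃ E : Submodule ℝ Y, FiniteDimensional ℝ E ∧ ∃ c > 0,
      (∀ y ∈ E, (1 + c) * ‖y‖ ^ 2 ≤ ⟪T y, y⟫_ℝ) ∧
      ∀ y ∈ Eᗮ, ⟪T y, y⟫_ℝ ≤ (1 - c) * ‖y‖ ^ 2 := by
  set E : Submodule ℝ Y :=
    ⨆ t : Ioi (1 : ℝ), Module.End.eigenspace (T : Module.End ℝ Y) t
  have hno : ¬ Module.End.HasEigenvalue (T : Module.End ℝ Y) 1 := by
    intro h
    obtain ⟨y, hy⟩ := h.exists_hasEigenvector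
    exact hy.2 (h1 y (by simpa using hy.apply_eq_smul))
  obtain ⟨K, hK⟩ := hT.antilipschitz_of_not_hasEigenvalue one_ne_zero hno
  obtain ⟨c, hc0, hc⟩ := antilipschitzWith_iff_exists_mul_le_norm.1 ⟨K, hK⟩
  have hE : ∀ y ∈ E, (1 + c) * ‖y‖ ^ 2 ≤ ⟪T y, y⟫_ℝ := by
    refine fun y hy => le_inner_of_mem_iSup_eigenspace hsymm (fun t ht hev => ?_) hy
    obtain ⟨x, hx⟩ := hev.exists_hasEigenvector
    have hTx : T x = t • x := hx.apply_eq_smul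
    have h := hc x
    have hx0 : 0 < ‖x‖ := norm_pos_iff.2 hx.2
    have h2 : (T - (1 : ℝ) • (1 : Y →L[ℝ] Y)) x = (t - 1) • x := by
      simp [hTx, sub_smul]
    rw [h2, norm_smul, Real.norm_of_nonneg (sub_nonneg.2 (le_of_lt ht))] at h
    have := le_of_mul_le_mul_right h hx0
    linarith
  have hinv : ∀ y ∈ E, T y ∈ E := by
    intro y hy
    have : E ≤ E.comap (T : Y →ₗ[ℝ] Y) := by
      refine iSup_le fun t x hx => ?_
      rw [Submodule.mem_comap]
      have hTx : T x = (t : ℝ) • x := Module.End.mem_eigenspace_iff.1 hx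
      change T x ∈ E
      rw [hTx]
      exact E.smul_mem _ (Submodule.mem_iSup_of_mem t hx)
    exact this hy
  have hfin : FiniteDimensional ℝ E := by
    refine finiteDimensional_of_norm_sq_le_inner hT hinv fun y hy => le_trans ?_ (hE y hy)
    nlinarith [sq_nonneg ‖y‖]
  have hinvF : ∀ y ∈ Eᗮ, T y ∈ Eᗮ := by
    intro y hy
    rw [Submodule.mem_orthogonal] at hy ⊢
    intro x hx
    have := hsymm x y
    exact this ▸ hy _ (hinv x hx)
  let S : Eᗮ →L[ℝ] Eᗮ := T.restrict hinvF
  have hS : IsCompactOperator S :=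
    IsCompactOperator.restrict (f := (T : Y →ₗ[ℝ] Y)) hT hinvF E.isClosed_orthogonal
  have hSsymm : S.IsSymmetric := fun x y => hsymm x y
  have hSlt : ‖S‖ < 1 := by
    by_contra! hge
    have hnt : Nontrivial Eᗮ := by
      by_contra hn
      rw [not_nontrivial_iff_subsingleton] at hn
      have : ‖S‖ = 0 := le_antisymm
        (S.opNorm_le_bound le_rfl fun x => by simp [Subsingleton.elim x 0]) S.opNorm_nonneg
      linarith
    rcases hS.hasEigenvalue_or_mem_resolventSet (μ := ‖S‖) (by positivity) with h | h
    · obtain ⟨x, hx⟩ := h.exists_hasEigenvector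
      have hTx : T (x : Y) = ‖S‖ • (x : Y) := congrArg Subtype.val hx.apply_eq_smul
      have hx0 : (x : Y) ≠ 0 := fun h => hx.2 (Subtype.ext h)
      rcases hge.eq_or_lt with he | hlt
      · rw [← he, one_smul] at hTx
        exact hx0 (h1 _ hTx)
      · have hxE : (x : Y) ∈ E := Submodule.mem_iSup_of_mem (⟨‖S‖, hlt⟩ : Ioi (1 : ℝ))
          (Module.End.mem_eigenspace_iff.2 hTx)
        exact hx0 (inner_self_eq_zero.1 (x.2 _ hxE))
    -- The Rayleigh quotients would stay below `‖S‖ - ε`, although their supremum is `‖S‖` by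
    -- symmetry and nonnegativity.
    · obtain ⟨ε, hε, hle⟩ := S.rayleighQuotient_le_of_norm_mem_resolventSet (𝕜 := ℝ) h
      have hn : ‖S‖ ≤ ‖S‖ - ε := by
        conv_lhs => rw [S.norm_eq_iSup_rayleighQuotient hSsymm]
        refine ciSup_le fun x => ?_
        rw [abs_of_nonneg]
        · exact hle x
        · refine div_nonneg ?_ (sq_nonneg _)
          exact hpos x
      linarith
  refine ⟨E, hfin, min c (1 - ‖S‖), lt_min hc0 (by linarith), fun y hy => ?_, fun y hy => ?_⟩
  · refine le_trans ?_ (hE y hy)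
    gcongr
    exact min_le_left _ _
  · have h : ⟪T y, y⟫_ℝ ≤ ‖S‖ * ‖y‖ ^ 2 := by
      have h2 : ⟪S ⟨y, hy⟩, (⟨y, hy⟩ : Eᗮ)⟫_ℝ ≤ ‖S‖ * ‖y‖ * ‖y‖ :=
        (real_inner_le_norm _ _).trans
          (mul_le_mul_of_nonneg_right (S.le_opNorm ⟨y, hy⟩) (norm_nonneg _))
      rw [pow_two, ← mul_assoc]
      exact h2
    refine h.trans ?_
    gcongr
    linarith [min_le_right c (1 - ‖S‖)]

/-- A continuous family of compact nonnegative operators whose positive index (relative to `1`)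
blows up at `0` has `1` as an eigenvalue for arbitrarily small values of the parameter. -/
theorem exists_fixed_vector_of_hasPosSubspace {J : ℝ → Y →L[ℝ] Y}
    (hcont : ContinuousOn J (Ioi 0)) (hcomp : ∀ t > 0, IsCompactOperator (J t))
    (hsymm : ∀ t > 0, (J t).IsSymmetric) (hpos : ∀ t > 0, ∀ y, 0 ≤ ⟪J t y, y⟫_ℝ)
    (hblow : ∀ n, ∀ᶠ t in 𝓝[>] (0 : ℝ), HasPosSubspace (J t) n) {ε : ℝ} (hε : 0 < ε) :
    ∃ t ∈ Ioo 0 ε, ∃ y ≠ 0, J t y = y := by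
  by_contra! hcon
  have hgap : ∀ t ∈ Ioo 0 ε, ∃ N : ℕ, ∀ᶠ s in 𝓝[Ioo 0 ε] t, ∀ n,
      HasPosSubspace (J s) n ↔ n ≤ N := by
    intro t ht
    obtain ⟨E, hE, c, hc, h1, h2⟩ := exists_spectral_gap_at_one (hcomp t ht.1) (hsymm t ht.1)
      (hpos t ht.1) (fun y hy => by_contra fun h => hcon t ht y h hy)
    refine ⟨Module.finrank ℝ E, ?_⟩
    have hc' : ContinuousWithinAt J (Ioo 0 ε) t := (hcont t ht.1).mono Ioo_subset_Ioi_self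
    have := hc'.eventually (Metric.ball_mem_nhds (J t) hc)
    filter_upwards [this] with s hs n
    exact hasPosSubspace_iff_of_gap h1 h2 (by rwa [← dist_eq_norm]) n
  have hconst : ∀ n, ∀ s ∈ Ioo 0 ε, ∀ t ∈ Ioo 0 ε,
      (HasPosSubspace (J s) n ↔ HasPosSubspace (J t) n) := by
    intro n s hs t ht
    -- A locally constant index on a connected interval is constant.
    refine isPreconnected_Ioo.induction₂
      (fun s t => HasPosSubspace (J s) n ↔ HasPosSubspace (J t) n) (fun r hr => ?_)
      (fun _ _ _ _ _ _ => Iff.trans) (fun _ _ _ _ => Iff.symm) hs ht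
    obtain ⟨N, hN⟩ := hgap r hr
    filter_upwards [hN] with q hq
    rw [hN.self_of_nhdsWithin hr n, hq n]
  have hm : ε / 2 ∈ Ioo 0 ε := ⟨by linarith, by linarith⟩
  obtain ⟨N, hN⟩ := hgap _ hm
  have hN' := hN.self_of_nhdsWithin hm
  obtain ⟨s, hs1, hs2⟩ := ((hblow (N + 1)).and (Ioo_mem_nhdsGT hε)).exists
  have := (hN' (N + 1)).1 ((hconst _ s hs2 _ hm).1 hs1)
  omega

end PositiveIndex

/-! ### Multiplication operators, weak derivatives and the resolvent on `L²`. -/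

section L2

open scoped InnerProductSpace BoundedContinuousFunction

/-- Real square integrable functions on the line. -/
abbrev L2R : Type := Lp ℝ 2 (volume : Measure ℝ)

theorem L2R.inner_eq_integral (f h : L2R) : ⟪f, h⟫_ℝ = ∫ x, f x * h x := by
  rw [L2.inner_def]
  exact integral_congr_ae (.of_forall fun x => mul_comm _ _)

/-- A continuous compactly supported function as an element of `L²`. -/
noncomputable def testL2 (η : ℝ → ℝ) (hη : Continuous η) (hc : HasCompactSupport η) : L2R :=
  (hη.memLp_of_hasCompactSupport hc).toLp η

theorem coeFn_testL2 {η : ℝ → ℝ} (hη : Continuous η) (hc : HasCompactSupport η) :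
    testL2 η hη hc =ᵐ[volume] η :=
  MemLp.coeFn_toLp _

theorem inner_testL2 (f : L2R) {η : ℝ → ℝ} (hη : Continuous η) (hc : HasCompactSupport η) :
    ⟪f, testL2 η hη hc⟫_ℝ = ∫ x, f x * η x := by
  rw [L2R.inner_eq_integral]
  refine integral_congr_ae ?_
  filter_upwards [coeFn_testL2 hη hc] with x hx
  rw [hx]

theorem memLp_bounded_mul (b : ℝ →ᵇ ℝ) (f : L2R) : MemLp (fun x => b x * f x) 2 volume :=
  (Lp.memLp f).of_le_mul (c := ‖b‖)
    (b.continuous.aestronglyMeasurable.mul (Lp.aestronglyMeasurable f))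
    (.of_forall fun x => by
      rw [norm_mul]
      exact mul_le_mul_of_nonneg_right (b.norm_coe_le_norm x) (norm_nonneg _))

/-- Multiplication by a bounded continuous function as an operator on `L²`. -/
noncomputable def mulL2 (b : ℝ →ᵇ ℝ) : L2R →L[ℝ] L2R :=
  LinearMap.mkContinuous
    { toFun := fun f => (memLp_bounded_mul b f).toLp
      map_add' := fun f h => by
        rw [← MemLp.toLp_add]
        refine MemLp.toLp_congr _ _ ?_
        filter_upwards [Lp.coeFn_add f h] with x hx
        simp only [hx, Pi.add_apply, mul_add]
      map_smul' := fun c f => by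
        rw [RingHom.id_apply, ← MemLp.toLp_const_smul]
        refine MemLp.toLp_congr _ _ ?_
        filter_upwards [Lp.coeFn_smul c f] with x hx
        simp only [hx, Pi.smul_apply, smul_eq_mul]
        ring } ‖b‖ fun f => by
    refine Lp.norm_le_mul_norm_of_ae_le_mul ?_
    filter_upwards [(memLp_bounded_mul b f).coeFn_toLp] with x hx
    change ‖(memLp_bounded_mul b f).toLp _ x‖ ≤ _
    rw [hx, norm_mul]
    exact mul_le_mul_of_nonneg_right (b.norm_coe_le_norm x) (norm_nonneg _)

theorem coeFn_mulL2 (b : ℝ →ᵇ ℝ) (f : L2R) : mulL2 b f =ᵐ[volume] fun x => b x * f x :=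
  (memLp_bounded_mul b f).coeFn_toLp

theorem inner_mulL2 (b : ℝ →ᵇ ℝ) (f h : L2R) :
    ⟪mulL2 b f, h⟫_ℝ = ∫ x, b x * (f x * h x) := by
  rw [L2R.inner_eq_integral]
  refine integral_congr_ae ?_
  filter_upwards [coeFn_mulL2 b f] with x hx
  rw [hx, mul_assoc]

theorem inner_mulL2_right (b : ℝ →ᵇ ℝ) (f h : L2R) :
    ⟪f, mulL2 b h⟫_ℝ = ⟪mulL2 b f, h⟫_ℝ := by
  rw [real_inner_comm, inner_mulL2, inner_mulL2]
  simp only [mul_comm]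

theorem adjoint_mulL2 (b : ℝ →ᵇ ℝ) : ContinuousLinearMap.adjoint (mulL2 b) = mulL2 b := by
  refine ((ContinuousLinearMap.eq_adjoint_iff _ _).2 fun f h => ?_).symm
  exact (inner_mulL2_right b f h).symm

theorem mulL2_mulL2 (b c : ℝ →ᵇ ℝ) (f : L2R) : mulL2 b (mulL2 c f) = mulL2 (b * c) f := by
  refine Lp.ext ?_
  filter_upwards [coeFn_mulL2 b (mulL2 c f), coeFn_mulL2 c f, coeFn_mulL2 (b * c) f]
    with x h1 h2 h3
  rw [h1, h2, h3, BoundedContinuousFunction.mul_apply, mul_assoc]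

theorem integrable_mul_L2 (f h : L2R) : Integrable (fun x => f x * h x) :=
  (Lp.memLp f).integrable_mul (Lp.memLp h)

theorem inner_mulL2_mono {b c : ℝ →ᵇ ℝ} (hbc : ∀ x, b x ≤ c x) (f : L2R) :
    ⟪mulL2 b f, f⟫_ℝ ≤ ⟪mulL2 c f, f⟫_ℝ := by
  rw [inner_mulL2, inner_mulL2]
  have hint : ∀ d : ℝ →ᵇ ℝ, Integrable (fun x => d x * (f x * f x)) := fun d => by
    refine (integrable_mul_L2 (mulL2 d f) f).congr ?_
    filter_upwards [coeFn_mulL2 d f] with x hx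
    rw [hx, mul_assoc]
  exact integral_mono (hint b) (hint c)
    fun x => mul_le_mul_of_nonneg_right (hbc x) (mul_self_nonneg _)

theorem inner_mulL2_nonneg {b : ℝ →ᵇ ℝ} (hb : ∀ x, 0 ≤ b x) (f : L2R) :
    0 ≤ ⟪mulL2 b f, f⟫_ℝ := by
  rw [inner_mulL2]
  exact integral_nonneg fun x => mul_nonneg (hb x) (mul_self_nonneg _)

/-! ### Weak derivatives in `L²` -/

/-- `h` is the weak derivative of `f`, tested against `C¹` functions of compact support. -/
def HasL2WeakDeriv (f h : L2R) : Prop :=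
  ∀ η : ℝ → ℝ, ContDiff ℝ 1 η → HasCompactSupport η →
    ∫ x, f x * deriv η x = - ∫ x, h x * η x

theorem hasL2WeakDeriv_iff_inner {f h : L2R} : HasL2WeakDeriv f h ↔
    ∀ (η : ℝ → ℝ) (hη : ContDiff ℝ 1 η) (hc : HasCompactSupport η),
      ⟪f, testL2 (deriv η) (hη.continuous_deriv le_rfl) hc.deriv⟫_ℝ =
        - ⟪h, testL2 η hη.continuous hc⟫_ℝ := by
  simp only [inner_testL2]
  rfl

namespace HasL2WeakDeriv

variable {f h f' h' : L2R}

theorem isWeakDeriv (H : HasL2WeakDeriv f h) : IsWeakDeriv f h :=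
  ⟨(Lp.memLp f).locallyIntegrable (by norm_num), (Lp.memLp h).locallyIntegrable (by norm_num),
    fun η hη hc => H η (hη.of_le (by exact_mod_cast le_top)) hc⟩

theorem add (H : HasL2WeakDeriv f h) (H' : HasL2WeakDeriv f' h') :
    HasL2WeakDeriv (f + f') (h + h') := by
  rw [hasL2WeakDeriv_iff_inner] at *
  intro η hη hc
  rw [inner_add_left, inner_add_left, H η hη hc, H' η hη hc]
  ring

theorem sub (H : HasL2WeakDeriv f h) (H' : HasL2WeakDeriv f' h') :
    HasL2WeakDeriv (f - f') (h - h') := by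
  rw [hasL2WeakDeriv_iff_inner] at *
  intro η hη hc
  rw [inner_sub_left, inner_sub_left, H η hη hc, H' η hη hc]
  ring

theorem smul (c : ℝ) (H : HasL2WeakDeriv f h) : HasL2WeakDeriv (c • f) (c • h) := by
  rw [hasL2WeakDeriv_iff_inner] at *
  intro η hη hc
  rw [real_inner_smul_left, real_inner_smul_left, H η hη hc]
  ring

/-- The product rule comes from testing with `b η`. Since `b` is only `C¹`, this needs `C¹` rather
than smooth test functions. -/
theorem mulL2 {b b' : ℝ →ᵇ ℝ} (hb : ContDiff ℝ 1 b) (hb' : ∀ x, deriv b x = b' x)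
    (H : HasL2WeakDeriv f h) :
    HasL2WeakDeriv (mulL2 b f) (mulL2 b' f + mulL2 b h) := by
  intro η hη hc
  have key := H (fun x => b x * η x) (hb.mul hη) hc.mul_left
  have hd : deriv (fun x => b x * η x) = fun x => b' x * η x + b x * deriv η x := by
    funext x
    rw [deriv_fun_mul (hb.differentiable one_ne_zero x) (hη.differentiable one_ne_zero x), hb']
  have hdc : Continuous (deriv η) := hη.continuous_deriv le_rfl
  have i1 : Integrable (fun x => _root_.mulL2 b f x * deriv η x) := by
    refine (integrable_mul_L2 (_root_.mulL2 b f) (testL2 _ hdc hc.deriv)).congr ?_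
    filter_upwards [coeFn_testL2 hdc hc.deriv] with x hx
    rw [hx]
  have i2 : Integrable (fun x => _root_.mulL2 b' f x * η x) := by
    refine (integrable_mul_L2 (_root_.mulL2 b' f) (testL2 _ hη.continuous hc)).congr ?_
    filter_upwards [coeFn_testL2 hη.continuous hc] with x hx
    rw [hx]
  have i3 : Integrable (fun x => _root_.mulL2 b h x * η x) := by
    refine (integrable_mul_L2 (_root_.mulL2 b h) (testL2 _ hη.continuous hc)).congr ?_
    filter_upwards [coeFn_testL2 hη.continuous hc] with x hx
    rw [hx]
  have e1 : ∫ x, f x * deriv (fun x => b x * η x) x =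
      (∫ x, _root_.mulL2 b f x * deriv η x) + ∫ x, _root_.mulL2 b' f x * η x := by
    rw [← integral_add i1 i2]
    refine integral_congr_ae ?_
    filter_upwards [coeFn_mulL2 b f, coeFn_mulL2 b' f] with x h1 h2
    rw [h1, h2, hd]
    ring
  have e2 : ∫ x, h x * (b x * η x) = ∫ x, _root_.mulL2 b h x * η x := by
    refine integral_congr_ae ?_
    filter_upwards [coeFn_mulL2 b h] with x h1
    rw [h1]
    ring
  have e3 : ∫ x, (_root_.mulL2 b' f + _root_.mulL2 b h : L2R) x * η x =
      (∫ x, _root_.mulL2 b' f x * η x) + ∫ x, _root_.mulL2 b h x * η x := by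
    rw [← integral_add i2 i3]
    refine integral_congr_ae ?_
    filter_upwards [Lp.coeFn_add (_root_.mulL2 b' f) (_root_.mulL2 b h)] with x h1
    rw [h1, Pi.add_apply, add_mul]
  rw [e3]
  rw [e1, e2] at key
  linarith

end HasL2WeakDeriv

/-! ### The Sobolev space `H¹` and the resolvent of the second derivative -/

/-- The pairs `(k η, η')` with `η` a `C¹` function of compact support. -/
noncomputable def testGraph (k : ℝ) : Submodule ℝ (WithLp 2 (L2R × L2R)) where
  carrier := {z | ∃ η : ℝ → ℝ, ContDiff ℝ 1 η ∧ HasCompactSupport η ∧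
    z.fst =ᵐ[volume] (fun x => k * η x) ∧ z.snd =ᵐ[volume] deriv η}
  add_mem' := by
    rintro z w ⟨η, hη, hc, h1, h2⟩ ⟨ζ, hζ, hd, h3, h4⟩
    refine ⟨fun x => η x + ζ x, hη.add hζ, hc.add hd, ?_, ?_⟩
    · filter_upwards [h1, h3, Lp.coeFn_add z.fst w.fst] with x h1 h3 h5
      rw [WithLp.add_fst, h5, Pi.add_apply, h1, h3, mul_add]
    · filter_upwards [h2, h4, Lp.coeFn_add z.snd w.snd] with x h1 h3 h5
      rw [WithLp.add_snd, h5, Pi.add_apply, h1, h3, deriv_fun_add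
        (hη.differentiable one_ne_zero x) (hζ.differentiable one_ne_zero x)]
  zero_mem' := by
    refine ⟨fun _ => 0, contDiff_const, HasCompactSupport.zero, ?_, ?_⟩
    · filter_upwards [Lp.coeFn_zero ℝ 2 (volume : Measure ℝ)] with x h1
      rw [WithLp.zero_fst, h1, Pi.zero_apply, mul_zero]
    · filter_upwards [Lp.coeFn_zero ℝ 2 (volume : Measure ℝ)] with x h1
      rw [WithLp.zero_snd, h1, Pi.zero_apply, deriv_const]
  smul_mem' := by
    rintro c z ⟨η, hη, hc, h1, h2⟩
    refine ⟨fun x => c * η x, contDiff_const.mul hη, hc.mul_left, ?_, ?_⟩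
    · filter_upwards [h1, Lp.coeFn_smul c z.fst] with x h1 h5
      rw [WithLp.smul_fst, h5, Pi.smul_apply, h1, smul_eq_mul]
      ring
    · filter_upwards [h2, Lp.coeFn_smul c z.snd] with x h1 h5
      rw [WithLp.smul_snd, h5, Pi.smul_apply, h1, smul_eq_mul, deriv_const_mul_field]

/-- The Sobolev space `H¹(ℝ)`, realised as the closure of the pairs `(k η, η')`. -/
noncomputable def sobolevGraph (k : ℝ) : Submodule ℝ (WithLp 2 (L2R × L2R)) :=
  (testGraph k).topologicalClosure

instance (k : ℝ) : CompleteSpace (sobolevGraph k) :=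
  (Submodule.isClosed_topologicalClosure _).completeSpace_coe

/-- The map `(k u, u') ↦ k u`. -/
noncomputable def graphFst (k : ℝ) : sobolevGraph k →L[ℝ] L2R :=
  (WithLp.fstL 2 ℝ L2R L2R).comp (sobolevGraph k).subtypeL

/-- The map `(k u, u') ↦ u'`. -/
noncomputable def graphSnd (k : ℝ) : sobolevGraph k →L[ℝ] L2R :=
  (WithLp.sndL 2 ℝ L2R L2R).comp (sobolevGraph k).subtypeL

theorem inner_sobolevGraph {k : ℝ} (z w : sobolevGraph k) :
    ⟪z, w⟫_ℝ = ⟪graphFst k z, graphFst k w⟫_ℝ + ⟪graphSnd k z, graphSnd k w⟫_ℝ := by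
  exact WithLp.prod_inner_apply _ _

/-- The element `(k η, η')` of `H¹`. -/
noncomputable def testElem (k : ℝ) {η : ℝ → ℝ} (hη : ContDiff ℝ 1 η) (hc : HasCompactSupport η) :
    sobolevGraph k :=
  ⟨WithLp.toLp 2 (k • testL2 η hη.continuous hc,
      testL2 (deriv η) (hη.continuous_deriv le_rfl) hc.deriv),
    Submodule.le_topologicalClosure _ ⟨η, hη, hc, by
      filter_upwards [Lp.coeFn_smul k (testL2 η hη.continuous hc),
        coeFn_testL2 hη.continuous hc] with x h1 h2
      change (k • testL2 η hη.continuous hc : L2R) x = _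
      rw [h1, Pi.smul_apply, h2, smul_eq_mul], coeFn_testL2 (hη.continuous_deriv le_rfl) hc.deriv⟩⟩

theorem graphFst_testElem (k : ℝ) {η : ℝ → ℝ} (hη : ContDiff ℝ 1 η) (hc : HasCompactSupport η) :
    graphFst k (testElem k hη hc) = k • testL2 η hη.continuous hc := rfl

theorem graphSnd_testElem (k : ℝ) {η : ℝ → ℝ} (hη : ContDiff ℝ 1 η) (hc : HasCompactSupport η) :
    graphSnd k (testElem k hη hc) = testL2 (deriv η) (hη.continuous_deriv le_rfl) hc.deriv := rfl

theorem integral_mul_deriv_test {η ζ : ℝ → ℝ} (hη : ContDiff ℝ 1 η) (hc : HasCompactSupport η)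
    (hζ : ContDiff ℝ 1 ζ) :
    ∫ x, η x * deriv ζ x = - ∫ x, deriv η x * ζ x :=
  integral_mul_deriv_eq_deriv_mul_of_integrable
    (fun x _ => (hη.differentiable one_ne_zero x).hasDerivAt)
    (fun x _ => (hζ.differentiable one_ne_zero x).hasDerivAt)
    ((hη.continuous.mul (hζ.continuous_deriv le_rfl)).integrable_of_hasCompactSupport hc.mul_right)
    (((hη.continuous_deriv le_rfl).mul hζ.continuous).integrable_of_hasCompactSupport
      hc.deriv.mul_right)
    ((hη.continuous.mul hζ.continuous).integrable_of_hasCompactSupport hc.mul_right)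

/-- For a fixed test function the identity is a closed condition, and on the dense test pairs it is
integration by parts. -/
theorem hasL2WeakDeriv_of_sobolevGraph {k : ℝ} (hk : k ≠ 0) (z : sobolevGraph k) :
    HasL2WeakDeriv (k⁻¹ • graphFst k z) (graphSnd k z) := by
  rw [hasL2WeakDeriv_iff_inner]
  intro ζ hζ hd
  set Z := testL2 ζ hζ.continuous hd
  set Z' := testL2 (deriv ζ) (hζ.continuous_deriv le_rfl) hd.deriv
  have hcl : IsClosed {w : WithLp 2 (L2R × L2R) |
      ⟪k⁻¹ • WithLp.fstL 2 ℝ L2R L2R w, Z'⟫_ℝ = -⟪WithLp.sndL 2 ℝ L2R L2R w, Z⟫_ℝ} :=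
    isClosed_eq (by fun_prop) (by fun_prop)
  refine closure_minimal ?_ hcl z.2
  rintro w ⟨η, hη, hc, h1, h2⟩
  have e1 : ⟪k⁻¹ • w.fst, Z'⟫_ℝ = ∫ x, η x * deriv ζ x := by
    rw [inner_testL2]
    refine integral_congr_ae ?_
    filter_upwards [h1, Lp.coeFn_smul k⁻¹ w.fst] with x h1 h3
    rw [h3, Pi.smul_apply, h1, smul_eq_mul, inv_mul_cancel_left₀ hk]
  have e2 : ⟪w.snd, Z⟫_ℝ = ∫ x, deriv η x * ζ x := by
    rw [inner_testL2]
    refine integral_congr_ae ?_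
    filter_upwards [h2] with x h2
    rw [h2]
  change ⟪k⁻¹ • w.fst, Z'⟫_ℝ = -⟪w.snd, Z⟫_ℝ
  rw [e1, e2, integral_mul_deriv_test hη hc hζ]

open ContinuousLinearMap (adjoint)

/-- The resolvent `(k² - d²/dx²)⁻¹` on `L²`. -/
noncomputable def resolventOp (k : ℝ) : L2R →L[ℝ] L2R :=
  (k⁻¹ ^ 2) • (graphFst k).comp (adjoint (graphFst k))

/-- The operator `d/dx (k² - d²/dx²)⁻¹` on `L²`. -/
noncomputable def resolventDeriv (k : ℝ) : L2R →L[ℝ] L2R :=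
  k⁻¹ • (graphSnd k).comp (adjoint (graphFst k))

/-- The derivative of the adjoint of `d/dx (k² - d²/dx²)⁻¹`. -/
noncomputable def resolventDerivDeriv (k : ℝ) : L2R →L[ℝ] L2R :=
  (graphSnd k).comp (adjoint (graphSnd k))

theorem adjoint_resolventOp (k : ℝ) : adjoint (resolventOp k) = resolventOp k := by
  rw [resolventOp, map_smulₛₗ, ContinuousLinearMap.adjoint_comp,
    ContinuousLinearMap.adjoint_adjoint]
  rfl

theorem adjoint_resolventDeriv (k : ℝ) :
    adjoint (resolventDeriv k) = k⁻¹ • (graphFst k).comp (adjoint (graphSnd k)) := by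
  rw [resolventDeriv, map_smulₛₗ, ContinuousLinearMap.adjoint_comp,
    ContinuousLinearMap.adjoint_adjoint]
  rfl

theorem hasL2WeakDeriv_resolventOp {k : ℝ} (hk : k ≠ 0) (f : L2R) :
    HasL2WeakDeriv (resolventOp k f) (resolventDeriv k f) := by
  have h := hasL2WeakDeriv_of_sobolevGraph hk (k⁻¹ • adjoint (graphFst k) f)
  rw [map_smul, map_smul, smul_smul, ← pow_two] at h
  exact h

theorem hasL2WeakDeriv_adjoint_resolventDeriv {k : ℝ} (hk : k ≠ 0) (f : L2R) :
    HasL2WeakDeriv (adjoint (resolventDeriv k) f) (resolventDerivDeriv k f) := by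
  rw [adjoint_resolventDeriv]
  exact hasL2WeakDeriv_of_sobolevGraph hk (adjoint (graphSnd k) f)

/-- This is `k² u - u'' = f` for `u = R f`. The adjoint of `graphFst` is the Riesz solution of the
weak form `∫ (k² u η + u' η') = ∫ f η`, up to the powers of `k` in the definitions. -/
theorem hasL2WeakDeriv_resolventDeriv {k : ℝ} (hk : k ≠ 0) (f : L2R) :
    HasL2WeakDeriv (resolventDeriv k f) (k ^ 2 • resolventOp k f - f) := by
  rw [hasL2WeakDeriv_iff_inner]
  intro η hη hc
  have h := inner_sobolevGraph (adjoint (graphFst k) f) (testElem k hη hc)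
  rw [ContinuousLinearMap.adjoint_inner_left, graphFst_testElem, graphSnd_testElem,
    real_inner_smul_right, real_inner_smul_right] at h
  rw [inner_sub_left, real_inner_smul_left, resolventOp, resolventDeriv]
  simp only [smul_apply, ContinuousLinearMap.comp_apply, real_inner_smul_left]
  field_simp
  linarith

/-- The adjoint of `d/dx R` is `-R d/dx`, so `w = adjoint (resolventDeriv k) f` solves `k² w - w'' =
-f'`. -/
theorem hasL2WeakDeriv_resolventDerivDeriv {k : ℝ} {f f' : L2R}
    (hf : HasL2WeakDeriv f f') :
    HasL2WeakDeriv (resolventDerivDeriv k f) (f' + k ^ 2 • adjoint (resolventDeriv k) f) := by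
  rw [hasL2WeakDeriv_iff_inner] at *
  intro η hη hc
  have h := inner_sobolevGraph (adjoint (graphSnd k) f) (testElem k hη hc)
  rw [ContinuousLinearMap.adjoint_inner_left, graphFst_testElem, graphSnd_testElem, hf η hη hc,
    real_inner_smul_right] at h
  rw [adjoint_resolventDeriv, inner_add_left, real_inner_smul_left, resolventDerivDeriv]
  simp only [smul_apply, ContinuousLinearMap.comp_apply, real_inner_smul_left]
  field_simp
  linarith

/-- Since `R` is a multiple of `graphFst` times its adjoint, `R f = 0` kills the adjoint at `f`, so
`f` is orthogonal to every test function. -/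
theorem resolventOp_injective {k : ℝ} (hk : k ≠ 0) {f : L2R} (hf : resolventOp k f = 0) :
    f = 0 := by
  have h0 : graphFst k (adjoint (graphFst k) f) = 0 := by
    have : (k⁻¹ ^ 2) • graphFst k (adjoint (graphFst k) f) = 0 := hf
    exact (smul_eq_zero.1 this).resolve_left (by positivity)
  have h1 : adjoint (graphFst k) f = 0 := by
    have h := ContinuousLinearMap.adjoint_inner_left (graphFst k) (adjoint (graphFst k) f) f
    rw [h0, inner_zero_right] at h
    exact inner_self_eq_zero.1 h
  have h2 : ∀ᵐ x, f x = 0 := by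
    refine ae_eq_zero_of_integral_contDiff_smul_eq_zero
      ((Lp.memLp f).locallyIntegrable (by norm_num)) fun η hη hc => ?_
    have hη1 : ContDiff ℝ 1 η := hη.of_le (by exact_mod_cast le_top)
    have h := ContinuousLinearMap.adjoint_inner_left (graphFst k) (testElem k hη1 hc) f
    rw [h1, inner_zero_left, graphFst_testElem, real_inner_smul_right, inner_testL2] at h
    have := (mul_eq_zero.1 h.symm).resolve_left hk
    simpa only [smul_eq_mul, mul_comm] using this
  refine Lp.ext ?_
  filter_upwards [h2, Lp.coeFn_zero ℝ 2 (volume : Measure ℝ)] with x h3 h4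
  rw [h3, h4, Pi.zero_apply]

end L2

/-! ### Rellich compactness by averaging over a grid. -/

section Compactness

open scoped InnerProductSpace BoundedContinuousFunction

/-- Cauchy–Schwarz, from the nonnegativity of the variance of `|f|`. -/
theorem sq_intervalIntegral_abs_le {f : ℝ → ℝ} (hf : Continuous f) {c d : ℝ} (hcd : c < d) :
    (∫ x in c..d, |f x|) ^ 2 ≤ (d - c) * ∫ x in c..d, f x ^ 2 := by
  set D := ∫ x in c..d, |f x|
  have hh : 0 < d - c := sub_pos.2 hcd
  have h0 : 0 ≤ ∫ x in c..d, (|f x| - D / (d - c)) ^ 2 :=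
    intervalIntegral.integral_nonneg hcd.le fun x _ => sq_nonneg _
  have h1 : ∫ x in c..d, (|f x| - D / (d - c)) ^ 2 =
      (∫ x in c..d, f x ^ 2) - 2 * (D / (d - c)) * D + (d - c) * (D / (d - c)) ^ 2 := by
    have : ∀ x, (|f x| - D / (d - c)) ^ 2 =
        f x ^ 2 - 2 * (D / (d - c)) * |f x| + (D / (d - c)) ^ 2 := fun x => by
      rw [sub_sq, sq_abs]
      ring
    simp_rw [this]
    rw [intervalIntegral.integral_add, intervalIntegral.integral_sub,
      intervalIntegral.integral_const_mul, intervalIntegral.integral_const, smul_eq_mul]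
    all_goals exact Continuous.intervalIntegrable (by fun_prop) _ _
  rw [h1] at h0
  field_simp at h0
  nlinarith

/-- A Poincaré inequality with a non-sharp constant: `η` differs from its mean by at most `∫ |η'|`
over the interval. -/
theorem integral_sub_mean_sq_le {η : ℝ → ℝ} (hη : ContDiff ℝ 1 η) {c d : ℝ} (hcd : c < d) :
    ∫ x in c..d, (η x - (d - c)⁻¹ * ∫ y in c..d, η y) ^ 2 ≤
      (d - c) ^ 2 * ∫ x in c..d, deriv η x ^ 2 := by
  have hh : 0 < d - c := sub_pos.2 hcd
  have hd : Continuous (deriv η) := hη.continuous_deriv le_rfl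
  have hηc := hη.continuous
  set D := ∫ x in c..d, |deriv η x|
  have hosc : ∀ x ∈ Icc c d, ∀ y ∈ Icc c d, |η x - η y| ≤ D := by
    intro x hx y hy
    have h1 : η x - η y = ∫ t in y..x, deriv η t :=
      (intervalIntegral.integral_deriv_eq_sub
        (fun t _ => hη.differentiable one_ne_zero t) (hd.intervalIntegrable _ _)).symm
    rw [h1, ← Real.norm_eq_abs]
    refine intervalIntegral.norm_integral_le_abs_integral_norm.trans ?_
    simp only [Real.norm_eq_abs]
    refine (intervalIntegral.abs_integral_mono_interval ?_ (.of_forall fun _ => abs_nonneg _)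
      (hd.abs.intervalIntegrable _ _)).trans (le_of_eq (abs_of_nonneg
        (intervalIntegral.integral_nonneg hcd.le fun _ _ => abs_nonneg _)))
    rw [uIoc_of_le hcd.le]
    exact Ioc_subset_Ioc (le_min hy.1 hx.1) (max_le hy.2 hx.2)
  have hmean : ∀ x ∈ Icc c d, |η x - (d - c)⁻¹ * ∫ y in c..d, η y| ≤ D := by
    intro x hx
    have h1 : η x - (d - c)⁻¹ * ∫ y in c..d, η y = (d - c)⁻¹ * ∫ y in c..d, (η x - η y) := by
      rw [intervalIntegral.integral_sub (by simp) (hηc.intervalIntegrable _ _),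
        intervalIntegral.integral_const, smul_eq_mul]
      field_simp
    have h2 : ‖∫ y in c..d, (η x - η y)‖ ≤ D * |d - c| :=
      intervalIntegral.norm_integral_le_of_norm_le_const fun y hy =>
        hosc x hx y (Ioc_subset_Icc_self (uIoc_of_le hcd.le ▸ hy))
    rw [h1, abs_mul, abs_of_pos (inv_pos.2 hh), inv_mul_le_iff₀ hh, mul_comm]
    rwa [abs_of_pos hh] at h2
  calc ∫ x in c..d, (η x - (d - c)⁻¹ * ∫ y in c..d, η y) ^ 2
      ≤ ∫ x in c..d, D ^ 2 := by
        refine intervalIntegral.integral_mono_on hcd.le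
          (Continuous.intervalIntegrable (by fun_prop) _ _) (by simp) fun x hx => ?_
        rw [← sq_abs]
        exact pow_le_pow_left₀ (abs_nonneg _) (hmean x hx) 2
    _ = (d - c) * D ^ 2 := by rw [intervalIntegral.integral_const, smul_eq_mul]
    _ ≤ (d - c) * ((d - c) * ∫ x in c..d, deriv η x ^ 2) :=
        mul_le_mul_of_nonneg_left (sq_intervalIntegral_abs_le hd hcd) hh.le
    _ = _ := by ring

/-- The indicator function of `(c, d]` in `L²`. -/
noncomputable def indicatorIoc (c d : ℝ) : L2R :=
  indicatorConstLp 2 (measurableSet_Ioc (a := c) (b := d)) measure_Ioc_lt_top.ne (1 : ℝ)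

theorem coeFn_indicatorIoc (c d : ℝ) :
    indicatorIoc c d =ᵐ[volume] (Ioc c d).indicator fun _ => 1 :=
  indicatorConstLp_coeFn

theorem inner_indicatorIoc (c d : ℝ) (f : L2R) :
    ⟪indicatorIoc c d, f⟫_ℝ = ∫ x in Ioc c d, f x :=
  L2.inner_indicatorConstLp_one _ _ f

/-- Averaging over the interval `(c, d]`. -/
noncomputable def cellAverage (c d : ℝ) : L2R →L[ℝ] L2R :=
  (d - c)⁻¹ • (innerSL ℝ (indicatorIoc c d)).smulRight (indicatorIoc c d)

theorem isCompactOperator_cellAverage (c d : ℝ) : IsCompactOperator (cellAverage c d) := by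
  have h : IsCompactOperator (innerSL ℝ (indicatorIoc c d)) :=
    isCompactOperator_of_locallyCompactSpace_dom _
  exact (h.clm_comp (ContinuousLinearMap.toSpanSingleton ℝ (indicatorIoc c d))).smul (d - c)⁻¹

theorem cellAverage_apply (c d : ℝ) (f : L2R) :
    cellAverage c d f = ((d - c)⁻¹ * ∫ x in Ioc c d, f x) • indicatorIoc c d := by
  rw [← inner_indicatorIoc, mul_smul]
  rfl

/-- Averaging over the cells `(p i, p (i + 1)]`, `i < N`. -/
noncomputable def gridAverage (p : ℕ → ℝ) (N : ℕ) : L2R →L[ℝ] L2R :=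
  ∑ i ∈ Finset.range N, cellAverage (p i) (p (i + 1))

theorem isCompactOperator_gridAverage (p : ℕ → ℝ) (N : ℕ) :
    IsCompactOperator (gridAverage p N) :=
  (compactOperator (RingHom.id ℝ) L2R L2R).sum_mem
    fun i _ => isCompactOperator_cellAverage (p i) (p (i + 1))

theorem ae_gridAverage {p : ℕ → ℝ} (hp : Monotone p) {N : ℕ} (f : L2R) :
    ∀ᵐ x, ∀ i < N, x ∈ Ioc (p i) (p (i + 1)) →
      gridAverage p N f x = (p (i + 1) - p i)⁻¹ * ∫ x in Ioc (p i) (p (i + 1)), f x := by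
  have h1 := Lp.coeFn_finsetSum (Finset.range N) fun i => cellAverage (p i) (p (i + 1)) f
  have h2 : ∀ᵐ x, ∀ j : ℕ, cellAverage (p j) (p (j + 1)) f x =
      ((p (j + 1) - p j)⁻¹ * ∫ x in Ioc (p j) (p (j + 1)), f x) *
        (Ioc (p j) (p (j + 1))).indicator (fun _ => 1) x := by
    refine ae_all_iff.2 fun j => ?_
    rw [cellAverage_apply]
    filter_upwards [coeFn_indicatorIoc (p j) (p (j + 1)),
      Lp.coeFn_smul ((p (j + 1) - p j)⁻¹ * ∫ x in Ioc (p j) (p (j + 1)), f x)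
        (indicatorIoc (p j) (p (j + 1)))] with x h3 h4
    rw [h4, Pi.smul_apply, h3, smul_eq_mul]
  have hsum : gridAverage p N f =
      ∑ i ∈ Finset.range N, cellAverage (p i) (p (i + 1)) f := by
    rw [gridAverage, sum_apply]
  rw [hsum]
  filter_upwards [h1, h2] with x h1 h2 i hi hx
  rw [h1, Finset.sum_apply, Finset.sum_eq_single i, h2, indicator_of_mem hx, mul_one]
  · intro j _ hji
    have hdis := hp.pairwise_disjoint_on_Ioc_succ hji
    have hxj : x ∉ Ioc (p j) (p (j + 1)) := fun hxj => Set.disjoint_left.1 hdis hxj hx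
    rw [h2, indicator_of_notMem hxj, mul_zero]
  · exact fun h => absurd (Finset.mem_range.2 hi) h

theorem norm_sq_eq_integral (f : L2R) : ‖f‖ ^ 2 = ∫ x, f x ^ 2 := by
  rw [← real_inner_self_eq_norm_sq, L2R.inner_eq_integral]
  simp only [pow_two]

/-- Poincaré on each cell, summed over the grid, gives the bound for test pairs; it passes to their
closure by continuity. -/
theorem norm_mulL2_sub_gridAverage_le {b : ℝ →ᵇ ℝ} {a : ℝ} {p : ℕ → ℝ} {N : ℕ} {h : ℝ}
    (hh : 0 < h) (hp : ∀ i, p (i + 1) - p i = h) (hp0 : p 0 = -a) (hpN : p N = a)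
    (hb : ∀ x ∉ Icc (-a) a, b x = 0) (k : ℝ) (z : sobolevGraph k) :
    ‖mulL2 b (graphFst k z - gridAverage p N (graphFst k z))‖ ≤ ‖b‖ * |k| * h * ‖z‖ := by
  have hmono : StrictMono p := strictMono_nat_of_lt_succ fun i => by linarith [hp i]
  let L : WithLp 2 (L2R × L2R) →L[ℝ] L2R :=
    (mulL2 b).comp ((ContinuousLinearMap.id ℝ L2R - gridAverage p N).comp
      (WithLp.fstL 2 ℝ L2R L2R))
  have hcl : IsClosed {w : WithLp 2 (L2R × L2R) | ‖L w‖ ≤ ‖b‖ * |k| * h * ‖w‖} :=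
    isClosed_le (by fun_prop) (by fun_prop)
  refine closure_minimal ?_ hcl z.2
  rintro w ⟨η, hη, hc, h1, h2⟩
  have hηc := hη.continuous
  have hηd : Continuous (deriv η) := hη.continuous_deriv le_rfl
  change ‖mulL2 b (w.fst - gridAverage p N w.fst)‖ ≤ ‖b‖ * |k| * h * ‖w‖
  set g := mulL2 b (w.fst - gridAverage p N w.fst) with hg
  have hint : Integrable (fun x => g x ^ 2) := (Lp.memLp g).integrable_sq
  have hgz : ∀ᵐ x, x ∉ Icc (-a) a → g x ^ 2 = 0 := by
    filter_upwards [coeFn_mulL2 b (w.fst - gridAverage p N w.fst)] with x hx hxa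
    rw [hg, hx, hb x hxa]
    ring
  have ha : -a ≤ a := by
    rw [← hp0, ← hpN]
    exact hmono.monotone zero_le
  -- The weight vanishes off `[-a, a]`, so finitely many cells carry the whole norm.
  have hnorm : ‖g‖ ^ 2 = ∑ i ∈ Finset.range N, ∫ x in p i..p (i + 1), g x ^ 2 := by
    rw [norm_sq_eq_integral, intervalIntegral.sum_integral_adjacent_intervals
      (fun i _ => hint.intervalIntegrable), hp0, hpN, intervalIntegral.integral_of_le ha,
      ← integral_Icc_eq_integral_Ioc, ← integral_indicator measurableSet_Icc]
    refine integral_congr_ae ?_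
    filter_upwards [hgz] with x hx
    by_cases hxa : x ∈ Icc (-a) a
    · rw [indicator_of_mem hxa]
    · rw [indicator_of_notMem hxa, hx hxa]
  have hcell : ∀ i < N, ∫ x in p i..p (i + 1), g x ^ 2 ≤
      (‖b‖ * |k| * h) ^ 2 * ∫ x in p i..p (i + 1), deriv η x ^ 2 := by
    intro i hi
    have hlt : p i < p (i + 1) := hmono (Nat.lt_succ_self i)
    have hmean : ∫ x in Ioc (p i) (p (i + 1)), w.fst x = k * ∫ y in p i..p (i + 1), η y := by
      rw [intervalIntegral.integral_of_le hlt.le, ← integral_const_mul]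
      exact integral_congr_ae (ae_restrict_of_ae h1)
    calc ∫ x in p i..p (i + 1), g x ^ 2
        ≤ ∫ x in p i..p (i + 1), (‖b‖ * |k|) ^ 2 *
          (η x - (p (i + 1) - p i)⁻¹ * ∫ y in p i..p (i + 1), η y) ^ 2 := by
          rw [intervalIntegral.integral_of_le hlt.le, intervalIntegral.integral_of_le hlt.le]
          refine setIntegral_mono_ae_restrict hint.integrableOn
            (Continuous.integrableOn_Ioc (by fun_prop)) ?_
          rw [EventuallyLE, ae_restrict_iff' measurableSet_Ioc]
          filter_upwards [coeFn_mulL2 b (w.fst - gridAverage p N w.fst),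
            Lp.coeFn_sub w.fst (gridAverage p N w.fst), h1,
            ae_gridAverage hmono.monotone (N := N) w.fst] with x e1 e2 e3 e4 hx
          rw [hg, e1, e2, Pi.sub_apply, e3, e4 i hi hx, hmean, mul_pow ‖b‖, sq_abs]
          have : (b x * (k * η x - (p (i + 1) - p i)⁻¹ * (k * ∫ y in p i..p (i + 1), η y))) ^ 2 =
              (b x) ^ 2 * (k ^ 2 *
                (η x - (p (i + 1) - p i)⁻¹ * ∫ y in p i..p (i + 1), η y) ^ 2) := by ring
          rw [this, mul_assoc]
          have hbx : (b x) ^ 2 ≤ ‖b‖ ^ 2 := by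
            rw [← sq_abs]
            exact pow_le_pow_left₀ (abs_nonneg _) (b.norm_coe_le_norm x) 2
          exact mul_le_mul_of_nonneg_right hbx (by positivity)
      _ ≤ (‖b‖ * |k|) ^ 2 * ((p (i + 1) - p i) ^ 2 * ∫ x in p i..p (i + 1), deriv η x ^ 2) := by
          rw [intervalIntegral.integral_const_mul]
          exact mul_le_mul_of_nonneg_left (integral_sub_mean_sq_le hη hlt) (sq_nonneg _)
      _ = _ := by rw [hp i]; ring
  have hsnd : ∑ i ∈ Finset.range N, ∫ x in p i..p (i + 1), deriv η x ^ 2 ≤ ‖w.snd‖ ^ 2 := by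
    rw [intervalIntegral.sum_integral_adjacent_intervals
      (fun i _ => Continuous.intervalIntegrable (by fun_prop) _ _), hp0, hpN,
      intervalIntegral.integral_of_le ha, norm_sq_eq_integral]
    have e : ∫ x, w.snd x ^ 2 = ∫ x, deriv η x ^ 2 := by
      refine integral_congr_ae ?_
      filter_upwards [h2] with x h2
      rw [h2]
    have hi : Integrable fun x => deriv η x ^ 2 :=
      (hηd.memLp_of_hasCompactSupport (p := 2) hc.deriv).integrable_sq
    rw [e]
    exact setIntegral_le_integral hi (.of_forall fun x => sq_nonneg _)
  have hw : ‖w.snd‖ ≤ ‖w‖ := by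
    have := WithLp.prod_norm_sq_eq_of_L2 w
    refine le_of_sq_le_sq ?_ (norm_nonneg _)
    rw [this]
    exact le_add_of_nonneg_left (sq_nonneg _)
  refine le_of_sq_le_sq ?_ (by positivity)
  calc ‖g‖ ^ 2 ≤ ∑ i ∈ Finset.range N,
        (‖b‖ * |k| * h) ^ 2 * ∫ x in p i..p (i + 1), deriv η x ^ 2 := by
        rw [hnorm]
        exact Finset.sum_le_sum fun i hi => hcell i (Finset.mem_range.1 hi)
    _ ≤ (‖b‖ * |k| * h) ^ 2 * ‖w‖ ^ 2 := by
        rw [← Finset.mul_sum]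
        refine mul_le_mul_of_nonneg_left (hsnd.trans ?_) (sq_nonneg _)
        exact pow_le_pow_left₀ (norm_nonneg _) hw 2
    _ = _ := by ring

/-- The grid averages have finite rank and approximate the operator in norm as the mesh `2a/(n+1)`
shrinks. -/
theorem isCompactOperator_mulL2_comp_graphFst {b : ℝ →ᵇ ℝ} {a : ℝ} (ha : 0 < a)
    (hb : ∀ x ∉ Icc (-a) a, b x = 0) (k : ℝ) :
    IsCompactOperator ((mulL2 b).comp (graphFst k)) := by
  let p : ℕ → ℕ → ℝ := fun n i => -a + i * (2 * a / (n + 1 : ℝ))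
  let F : ℕ → sobolevGraph k →L[ℝ] L2R := fun n =>
    (mulL2 b).comp ((gridAverage (p n) (n + 1)).comp (graphFst k))
  have hF : ∀ n, IsCompactOperator (F n) := fun n =>
    ((isCompactOperator_gridAverage (p n) (n + 1)).comp_clm (graphFst k)).clm_comp (mulL2 b)
  refine isCompactOperator_of_tendsto (F := F) (l := atTop) ?_ (.of_forall hF)
  refine (tendsto_iff_norm_sub_tendsto_zero (E := sobolevGraph k →L[ℝ] L2R)).2 ?_
  have hlim : Tendsto (fun n : ℕ => ‖b‖ * |k| * (2 * a) * (1 / ((n : ℝ) + 1))) atTop (𝓝 0) := by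
    simpa using (tendsto_one_div_add_atTop_nhds_zero_nat (𝕜 := ℝ)).const_mul
      (‖b‖ * |k| * (2 * a))
  refine squeeze_zero (fun n => (F n - (mulL2 b).comp (graphFst k)).opNorm_nonneg) (fun n => ?_) hlim
  refine (F n - (mulL2 b).comp (graphFst k)).opNorm_le_bound (by positivity) fun z => ?_
  have h := norm_mulL2_sub_gridAverage_le (b := b) (a := a) (p := p n) (N := n + 1)
    (h := 2 * a / (n + 1 : ℝ)) (by positivity) (fun i => by simp only [p]; push_cast; ring)
    (by simp [p]) (by simp only [p]; push_cast; field_simp; ring) hb k z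
  have e : (F n - (mulL2 b).comp (graphFst k)) z =
      -mulL2 b (graphFst k z - gridAverage (p n) (n + 1) (graphFst k z)) := by
    rw [map_sub, neg_sub]
    rfl
  rw [e, norm_neg]
  refine h.trans (le_of_eq ?_)
  ring

end Compactness

/-! ### Small eigenvalues of the quadratic pencil. -/

section Pencil

open scoped InnerProductSpace
open ContinuousLinearMap (adjoint)

variable {H Y : Type*} [NormedAddCommGroup H] [InnerProductSpace ℝ H]
  [NormedAddCommGroup Y] [InnerProductSpace ℝ Y]

/-- The operator `t μ + t² P`. -/
noncomputable def pencilOp (P : H →L[ℝ] H) (μ t : ℝ) : H →L[ℝ] H :=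
  (t * μ) • (1 : H →L[ℝ] H) + t ^ 2 • P

theorem pencilOp_apply (P : H →L[ℝ] H) (μ t : ℝ) (v : H) :
    pencilOp P μ t v = (t * μ) • v + t ^ 2 • P v := rfl

theorem le_inner_pencilOp {P : H →L[ℝ] H} (hP : ∀ v, 0 ≤ ⟪P v, v⟫_ℝ) (μ t : ℝ) (v : H) :
    t * μ * ‖v‖ ^ 2 ≤ ⟪pencilOp P μ t v, v⟫_ℝ := by
  rw [pencilOp_apply, inner_add_left, real_inner_smul_left, real_inner_smul_left,
    real_inner_self_eq_norm_sq]
  exact le_add_of_nonneg_right (mul_nonneg (sq_nonneg _) (hP v))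

variable [CompleteSpace H] [CompleteSpace Y]

theorem isUnit_pencilOp {P : H →L[ℝ] H} (hP : ∀ v, 0 ≤ ⟪P v, v⟫_ℝ) {μ t : ℝ} (hμ : 0 < μ)
    (ht : 0 < t) : IsUnit (pencilOp P μ t) := by
  refine ContinuousLinearMap.isUnit_of_forall_le_norm_inner_map _
    (c := ⟨t * μ, (mul_pos ht hμ).le⟩) (mul_pos ht hμ) fun x => ?_
  refine le_trans ?_ (le_abs_self _)
  rw [mul_comm]
  exact le_inner_pencilOp hP μ t x

theorem pencilOp_inverse_apply {P : H →L[ℝ] H} (hP : ∀ v, 0 ≤ ⟪P v, v⟫_ℝ) {μ t : ℝ}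
    (hμ : 0 < μ) (ht : 0 < t) (w : H) :
    pencilOp P μ t (Ring.inverse (pencilOp P μ t) w) = w := by
  have h := Ring.mul_inverse_cancel _ (isUnit_pencilOp hP hμ ht)
  exact congrArg (fun T : H →L[ℝ] H => T w) h

/-- A nonlinear eigenvalue problem `t μ v + t² P v = ι* ι v` with `ι` compact of infinite rank has
arbitrarily small positive eigenvalues `t`. -/
theorem exists_small_pencil_eigenvalue {P : H →L[ℝ] H} (hPs : P.IsSymmetric)
    (hP : ∀ v, 0 ≤ ⟪P v, v⟫_ℝ) {ι : H →L[ℝ] Y} (hι : IsCompactOperator ι)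
    (hrank : ∀ n : ℕ, ∃ V : Submodule ℝ Y, FiniteDimensional ℝ V ∧ n ≤ Module.finrank ℝ V ∧
      ∀ y ∈ V, adjoint ι y = 0 → y = 0) {μ : ℝ} (hμ : 0 < μ) {ε : ℝ} (hε : 0 < ε) :
    ∃ t ∈ Ioo 0 ε, ∃ v ≠ 0, pencilOp P μ t v = adjoint ι (ι v) := by
  let B : ℝ → H →L[ℝ] H := fun t => Ring.inverse (pencilOp P μ t)
  have hAB : ∀ t > 0, ∀ w, pencilOp P μ t (B t w) = w := fun t ht w =>
    pencilOp_inverse_apply hP hμ ht w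
  have hAs : ∀ t x y, ⟪pencilOp P μ t x, y⟫_ℝ = ⟪x, pencilOp P μ t y⟫_ℝ := by
    intro t x y
    have h : ⟪P x, y⟫_ℝ = ⟪x, P y⟫_ℝ := hPs x y
    simp only [pencilOp_apply, inner_add_left, inner_add_right, real_inner_smul_left,
      real_inner_smul_right, h]
  have hBs : ∀ t > 0, ∀ x y, ⟪B t x, y⟫_ℝ = ⟪x, B t y⟫_ℝ := by
    intro t ht x y
    conv_lhs => rw [← hAB t ht y]
    rw [← hAs, hAB t ht]
  -- Birman–Schwinger reduction: a fixed vector `y` of `J t` yields the pencil solution `B t (ι*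
  -- y)`.
  let J : ℝ → Y →L[ℝ] Y := fun t => ι.comp ((B t).comp (adjoint ι))
  have hJ : ∀ t y, ⟪J t y, y⟫_ℝ = ⟪B t (adjoint ι y), adjoint ι y⟫_ℝ := fun t y =>
    (ContinuousLinearMap.adjoint_inner_right ι _ _).symm
  have hBlow : ∀ t > 0, ∀ w, t * μ * ‖B t w‖ ^ 2 ≤ ⟪B t w, w⟫_ℝ := by
    intro t ht w
    have h := le_inner_pencilOp hP μ t (B t w)
    rwa [hAB t ht, real_inner_comm] at h
  have hcont : ContinuousOn J (Ioi 0) := by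
    intro t ht
    refine ContinuousAt.continuousWithinAt ?_
    have hA : Continuous (pencilOp P μ) := by
      unfold pencilOp
      fun_prop
    have hB : ContinuousAt B t := by
      obtain ⟨u, hu⟩ := isUnit_pencilOp hP hμ ht
      have h := NormedRing.inverse_continuousAt u
      rw [hu] at h
      exact ContinuousAt.comp (f := pencilOp P μ) h hA.continuousAt
    exact continuousAt_const.clm_comp (hB.clm_comp continuousAt_const)
  obtain ⟨t, ht, y, hy, hJy⟩ := exists_fixed_vector_of_hasPosSubspace (J := J) hcont
    (fun t _ => hι.comp_clm ((B t).comp (adjoint ι)))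
    (fun t ht x y => by
      change ⟪ι (B t (adjoint ι x)), y⟫_ℝ = ⟪x, ι (B t (adjoint ι y))⟫_ℝ
      rw [← ContinuousLinearMap.adjoint_inner_right, hBs t ht,
        ContinuousLinearMap.adjoint_inner_left])
    (fun t ht y => by
      rw [hJ]
      exact le_trans (mul_nonneg (mul_pos ht hμ).le (sq_nonneg _)) (hBlow t ht _))
    (fun n => by
      obtain ⟨V, hV, hn, hinj⟩ := hrank n
      let f : V →ₗ[ℝ] H := (adjoint ι : Y →ₗ[ℝ] H).comp V.subtype
      have hker : f.ker = ⊥ := by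
        rw [LinearMap.ker_eq_bot']
        exact fun y hy => Subtype.ext (hinj y y.2 hy)
      obtain ⟨K, hK0, hK⟩ := f.exists_antilipschitzWith hker
      obtain ⟨c, hc0, hc⟩ := (antilipschitzWith_iff_exists_mul_le_norm (f := f)).1 ⟨K, hK⟩
      set C := μ + ‖P‖
      have hC : 0 < C := add_pos_of_pos_of_nonneg hμ (norm_nonneg _)
      -- For `t ≤ 1`, `‖A(t)‖ ≤ t C`, so with `w = ι* y` one has `c ‖y‖ ≤ ‖w‖ ≤ t C ‖B t w‖`. Then
      -- `t μ ‖B t w‖² ≥ μ c² ‖y‖² / (t C²)`, which exceeds `‖y‖²` once `t < μ c² / C²`.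
      have hδ : 0 < min 1 (μ * c ^ 2 / C ^ 2) := by positivity
      filter_upwards [Ioo_mem_nhdsGT hδ] with t ht
      have ht0 : 0 < t := ht.1
      have ht1 : t ≤ 1 := (ht.2.trans_le (min_le_left _ _)).le
      have ht2 : t * C ^ 2 < μ * c ^ 2 := by
        have := ht.2.trans_le (min_le_right _ _)
        rwa [lt_div_iff₀ (by positivity)] at this
      refine ⟨V, hV, hn, fun y hy hy0 => ?_⟩
      rw [hJ]
      refine lt_of_lt_of_le ?_ (hBlow t ht0 _)
      set w := adjoint ι y
      have hw : c * ‖y‖ ≤ ‖w‖ := hc ⟨y, hy⟩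
      have hAw : ‖w‖ ≤ t * C * ‖B t w‖ := by
        conv_lhs => rw [← hAB t ht0 w]
        rw [pencilOp_apply]
        have e1 : ‖(t * μ) • B t w‖ = t * μ * ‖B t w‖ := by
          rw [norm_smul, Real.norm_of_nonneg (by positivity)]
        have e2 : ‖t ^ 2 • P (B t w)‖ ≤ t * (‖P‖ * ‖B t w‖) := by
          rw [norm_smul, Real.norm_of_nonneg (by positivity)]
          have h3 := P.le_opNorm (B t w)
          have h4 : t ^ 2 ≤ t := by nlinarith
          gcongr
        refine (norm_add_le _ _).trans ?_
        rw [e1]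
        refine (add_le_add_right e2 _).trans (le_of_eq ?_)
        ring
      have hy' : 0 < ‖y‖ := norm_pos_iff.2 hy0
      have h5 : (c * ‖y‖) ^ 2 ≤ (t * C * ‖B t w‖) ^ 2 :=
        pow_le_pow_left₀ (by positivity) (hw.trans hAw) 2
      have h6 : t * C ^ 2 * ‖y‖ ^ 2 < t * C ^ 2 * (t * μ * ‖B t w‖ ^ 2) := by
        calc t * C ^ 2 * ‖y‖ ^ 2 < μ * c ^ 2 * ‖y‖ ^ 2 := by gcongr
          _ = μ * (c * ‖y‖) ^ 2 := by ring
          _ ≤ μ * (t * C * ‖B t w‖) ^ 2 := by gcongr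
          _ = _ := by ring
      exact lt_of_mul_lt_mul_left h6 (by positivity)) hε
  refine ⟨t, ht, B t (adjoint ι y), fun h0 => hy ?_, ?_⟩
  · rw [← hJy]
    change ι (B t (adjoint ι y)) = 0
    rw [h0, map_zero]
  · rw [hAB t ht.1]
    exact congrArg (adjoint ι) hJy.symm

end Pencil

/-! ### The Rayleigh–Taylor pencil: rank, regularity and growth-rate bound. -/

section RayleighTaylor

open scoped InnerProductSpace BoundedContinuousFunction
open ContinuousLinearMap (adjoint)

theorem IsWeakDeriv.congr_left {f f' h : ℝ → ℝ} (H : IsWeakDeriv f h) (hf : f =ᵐ[volume] f') :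
    IsWeakDeriv f' h := by
  refine ⟨H.1.congr hf, H.2.1, fun η hη hc => ?_⟩
  rw [← H.2.2 η hη hc]
  refine integral_congr_ae ?_
  filter_upwards [hf] with x hx
  rw [hx]

/-- In the variable `v = k² φ - φ''` the inertial part `k² ρ φ - (ρ φ')'` of the Rayleigh-Taylor
equation, after applying `(k² - d²/dx²)⁻¹`. -/
noncomputable def inertiaOp (k : ℝ) (r : ℝ →ᵇ ℝ) : L2R →L[ℝ] L2R :=
  k ^ 2 • (resolventOp k).comp ((mulL2 r).comp (resolventOp k)) +
    (adjoint (resolventDeriv k)).comp ((mulL2 r).comp (resolventDeriv k))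

theorem inertiaOp_apply (k : ℝ) (r : ℝ →ᵇ ℝ) (v : L2R) :
    inertiaOp k r v = k ^ 2 • resolventOp k (mulL2 r (resolventOp k v)) +
      adjoint (resolventDeriv k) (mulL2 r (resolventDeriv k v)) := rfl

theorem inner_resolventOp (k : ℝ) (f h : L2R) :
    ⟪resolventOp k f, h⟫_ℝ = ⟪f, resolventOp k h⟫_ℝ := by
  conv_lhs => rw [← adjoint_resolventOp]
  exact ContinuousLinearMap.adjoint_inner_left _ _ _

theorem inner_inertiaOp (k : ℝ) (r : ℝ →ᵇ ℝ) (v w : L2R) :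
    ⟪inertiaOp k r v, w⟫_ℝ = k ^ 2 * ⟪mulL2 r (resolventOp k v), resolventOp k w⟫_ℝ +
      ⟪mulL2 r (resolventDeriv k v), resolventDeriv k w⟫_ℝ := by
  rw [inertiaOp_apply, inner_add_left, real_inner_smul_left, inner_resolventOp,
    ContinuousLinearMap.adjoint_inner_left]

theorem isSymmetric_inertiaOp (k : ℝ) (r : ℝ →ᵇ ℝ) : (inertiaOp k r).IsSymmetric := by
  intro v w
  change ⟪inertiaOp k r v, w⟫_ℝ = ⟪v, inertiaOp k r w⟫_ℝ
  rw [real_inner_comm (inertiaOp k r w), inner_inertiaOp, inner_inertiaOp, ← inner_mulL2_right,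
    ← inner_mulL2_right, real_inner_comm, real_inner_comm (resolventDeriv k v)]

theorem inner_inertiaOp_nonneg (k : ℝ) {r : ℝ →ᵇ ℝ} (hr : ∀ x, 0 ≤ r x) (v : L2R) :
    0 ≤ ⟪inertiaOp k r v, v⟫_ℝ := by
  rw [inner_inertiaOp]
  exact add_nonneg (mul_nonneg (sq_nonneg _) (inner_mulL2_nonneg hr _)) (inner_mulL2_nonneg hr _)

/-- The compact operator `s (k² - d²/dx²)⁻¹`. -/
noncomputable def weightedResolvent (k : ℝ) (s : ℝ →ᵇ ℝ) : L2R →L[ℝ] L2R :=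
  (mulL2 s).comp (resolventOp k)

theorem adjoint_weightedResolvent_apply (k : ℝ) (s : ℝ →ᵇ ℝ) (f : L2R) :
    adjoint (weightedResolvent k s) f = resolventOp k (mulL2 s f) := by
  rw [weightedResolvent, ContinuousLinearMap.adjoint_comp, adjoint_mulL2, adjoint_resolventOp]
  rfl

theorem isCompactOperator_weightedResolvent (k : ℝ) {s : ℝ →ᵇ ℝ} {a : ℝ} (ha : 0 < a)
    (hs : ∀ x ∉ Icc (-a) a, s x = 0) : IsCompactOperator (weightedResolvent k s) := by
  have e : ⇑(weightedResolvent k s) =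
      ((k⁻¹ ^ 2) • ⇑((mulL2 s).comp (graphFst k))) ∘ ⇑(adjoint (graphFst k)) :=
    funext fun f => map_smul (mulL2 s) (k⁻¹ ^ 2) (graphFst k (adjoint (graphFst k) f))
  rw [e]
  exact ((isCompactOperator_mulL2_comp_graphFst ha hs k).smul (k⁻¹ ^ 2)).comp_clm
    (adjoint (graphFst k))

/-- Take the span of indicators of disjoint cells in `(c, d]`. The adjoint is `R s`; `R` is
injective, and so is multiplication by `s` on functions supported where `s ≠ 0`. -/
theorem exists_finiteDimensional_adjoint_weightedResolvent_injOn {k : ℝ} (hk : k ≠ 0)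
    {s : ℝ →ᵇ ℝ} {c d : ℝ} (hcd : c < d) (hs : ∀ x ∈ Ioc c d, s x ≠ 0) (n : ℕ) :
    ∃ V : Submodule ℝ L2R, FiniteDimensional ℝ V ∧ n ≤ Module.finrank ℝ V ∧
      ∀ y ∈ V, adjoint (weightedResolvent k s) y = 0 → y = 0 := by
  -- Dividing by `n + 1` keeps the mesh positive when `n = 0`; only the first `n` cells are used.
  let p : ℕ → ℝ := fun i => c + i * ((d - c) / (n + 1))
  have hh : 0 < (d - c) / (n + 1) := div_pos (sub_pos.2 hcd) (by positivity)
  have hp : StrictMono p := strictMono_nat_of_lt_succ fun i => by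
    simp only [p]
    push_cast
    linarith
  let e : Fin n → L2R := fun i => indicatorIoc (p i) (p (i + 1))
  have hsub : ∀ i : Fin n, Ioc (p i) (p (i + 1)) ⊆ Ioc c d := by
    intro i
    have h0 : p 0 = c := by simp [p]
    have h1 : p (n + 1) = d := by
      simp only [p]
      push_cast
      field_simp
      ring
    rw [← h0, ← h1]
    exact Ioc_subset_Ioc (hp.monotone zero_le)
      (hp.monotone (Nat.succ_le_succ i.is_lt.le))
  have hinner : ∀ i j : Fin n, ⟪e i, e j⟫_ℝ =
      volume.real (Ioc (p i) (p (i + 1)) ∩ Ioc (p j) (p (j + 1))) := fun i j =>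
    L2.inner_indicatorConstLp_one_indicatorConstLp_one (𝕜 := ℝ) _ _ _ _
  have hli : LinearIndependent ℝ e := by
    refine linearIndependent_of_ne_zero_of_inner_eq_zero (𝕜 := ℝ) (fun i hi => ?_)
      fun i j hij => ?_
    · have h := hinner i i
      rw [hi, inner_zero_left, inter_self, Real.volume_real_Ioc] at h
      have : 0 < max (p (i + 1) - p i) 0 :=
        lt_max_of_lt_left (sub_pos.2 (hp (Nat.lt_succ_self i)))
      exact this.ne h
    · have hne : (i : ℕ) ≠ j := fun h => hij (Fin.ext h)
      have hdis : Disjoint (Ioc (p i) (p (i + 1))) (Ioc (p j) (p (j + 1))) :=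
        hp.monotone.pairwise_disjoint_on_Ioc_succ hne
      change ⟪e i, e j⟫_ℝ = 0
      rw [hinner, Set.disjoint_iff_inter_eq_empty.1 hdis, measureReal_empty]
  let Z : Submodule ℝ L2R :=
    { carrier := {y | ∀ᵐ x, x ∉ Ioc c d → y x = 0}
      add_mem' := by
        intro y z hy hz
        filter_upwards [hy, hz, Lp.coeFn_add y z] with x h1 h2 h3 hx
        rw [h3, Pi.add_apply, h1 hx, h2 hx, add_zero]
      zero_mem' := by
        filter_upwards [Lp.coeFn_zero ℝ 2 (volume : Measure ℝ)] with x h1 _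
        rw [h1, Pi.zero_apply]
      smul_mem' := by
        intro t y hy
        filter_upwards [hy, Lp.coeFn_smul t y] with x h1 h3 hx
        rw [h3, Pi.smul_apply, h1 hx, smul_zero] }
  have hVZ : Submodule.span ℝ (range e) ≤ Z := by
    rw [Submodule.span_le]
    rintro _ ⟨i, rfl⟩
    filter_upwards [coeFn_indicatorIoc (p i) (p (i + 1))] with x h1 hx
    rw [h1, indicator_of_notMem fun h => hx (hsub i h)]
  refine ⟨Submodule.span ℝ (range e), FiniteDimensional.span_of_finite ℝ (finite_range e),
    ?_, fun y hy h0 => ?_⟩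
  · rw [finrank_span_eq_card hli, Fintype.card_fin]
  · rw [adjoint_weightedResolvent_apply] at h0
    have h1 := resolventOp_injective hk h0
    have h2 : ∀ᵐ x, x ∉ Ioc c d → y x = 0 := hVZ hy
    refine Lp.ext ?_
    have h3 : mulL2 s y =ᵐ[volume] (0 : L2R) := by rw [h1]
    filter_upwards [h2, h3, coeFn_mulL2 s y, Lp.coeFn_zero ℝ 2 (volume : Measure ℝ)]
      with x h2 h3 h4 h5
    rw [h5, Pi.zero_apply]
    by_cases hx : x ∈ Ioc c d
    · rw [h4, h5, Pi.zero_apply] at h3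
      exact (mul_eq_zero.1 h3).resolve_left (hs x hx)
    · exact h2 hx

/-- Solutions `v` of the pencil equation yield `H⁴` solutions `φ = (k² - d²/dx²)⁻¹ v` of the
Rayleigh-Taylor equation. -/
theorem memSobolevH_and_solves_of_pencil {g k μ t : ℝ} (hk : k ≠ 0) (hμ : μ ≠ 0) (ht : t ≠ 0)
    {r r' s : ℝ →ᵇ ℝ} (hr : ContDiff ℝ 1 r) (hr' : ∀ x, deriv r x = r' x)
    (hs : ∀ x, s x * s x = g * k ^ 2 * r' x) {v : L2R}
    (hv : pencilOp (inertiaOp k r) μ t v =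
      adjoint (weightedResolvent k s) (weightedResolvent k s v)) :
    MemSobolevH 4 (resolventOp k v) ∧ SolvesRayleighTaylorODE g k μ r t (resolventOp k v) := by
  have hR := fun f => hasL2WeakDeriv_resolventOp hk f
  have hD := fun f => hasL2WeakDeriv_resolventDeriv hk f
  set u := resolventOp k v
  set u₁ := resolventDeriv k v
  set u₂ := k ^ 2 • u - v with hu₂
  set G := mulL2 (s * s) u
  set W := mulL2 r' u₁ + mulL2 r u₂
  have d01 : HasL2WeakDeriv u u₁ := hR v
  have d12 : HasL2WeakDeriv u₁ u₂ := hD v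
  have dW : HasL2WeakDeriv (mulL2 r u₁) W := d12.mulL2 hr hr'
  -- Bootstrap: `v` is known only to be in `L²`, but both terms on the right have two weak
  -- derivatives in `L²`.
  have hv' : v = (t * μ)⁻¹ • (resolventOp k G - t ^ 2 • inertiaOp k r v) := by
    rw [adjoint_weightedResolvent_apply, pencilOp_apply] at hv
    have : mulL2 s (weightedResolvent k s v) = G := mulL2_mulL2 s s u
    rw [this] at hv
    rw [← hv, add_sub_cancel_right, inv_smul_smul₀ (mul_ne_zero ht hμ)]
  have dI : HasL2WeakDeriv (inertiaOp k r v)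
      (k ^ 2 • resolventDeriv k (mulL2 r u) + resolventDerivDeriv k (mulL2 r u₁)) :=
    ((hR _).smul _).add (hasL2WeakDeriv_adjoint_resolventDeriv hk _)
  have dI' : HasL2WeakDeriv
      (k ^ 2 • resolventDeriv k (mulL2 r u) + resolventDerivDeriv k (mulL2 r u₁))
      (k ^ 2 • inertiaOp k r v - k ^ 2 • mulL2 r u + W) := by
    have h := ((hD (mulL2 r u)).smul (k ^ 2)).add 
      (hasL2WeakDeriv_resolventDerivDeriv (k := k) dW)
    convert h using 1
    rw [inertiaOp_apply]
    module
  set v₁ := (t * μ)⁻¹ • (resolventDeriv k G - t ^ 2 •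
    (k ^ 2 • resolventDeriv k (mulL2 r u) + resolventDerivDeriv k (mulL2 r u₁))) with hv₁
  set v₂ := (t * μ)⁻¹ • ((k ^ 2 • resolventOp k G - G) - t ^ 2 •
    (k ^ 2 • inertiaOp k r v - k ^ 2 • mulL2 r u + W)) with hv₂
  have dv1 : HasL2WeakDeriv v v₁ := by
    have h := ((hR G).sub (dI.smul (t ^ 2))).smul (t * μ)⁻¹
    rwa [← hv'] at h
  have dv2 : HasL2WeakDeriv v₁ v₂ := ((hD G).sub (dI'.smul (t ^ 2))).smul (t * μ)⁻¹
  set u₃ := k ^ 2 • u₁ - v₁ with hu₃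
  set u₄ := k ^ 2 • u₂ - v₂ with hu₄
  have d23 : HasL2WeakDeriv u₂ u₃ := (d01.smul _).sub dv1
  have d34 : HasL2WeakDeriv u₃ u₄ := (d12.smul _).sub dv2
  -- Applying `k² - d²/dx²` to the pencil equation removes the outer resolvent.
  have heq : (t * μ) • (k ^ 2 • v - v₂) = G - t ^ 2 • (k ^ 2 • mulL2 r u - W) := by
    have h1 : (t * μ) • v = resolventOp k G - t ^ 2 • inertiaOp k r v := by
      conv_lhs => rw [hv']
      rw [smul_inv_smul₀ (mul_ne_zero ht hμ)]
    have h2 : (t * μ) • v₂ = (k ^ 2 • resolventOp k G - G) - t ^ 2 •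
        (k ^ 2 • inertiaOp k r v - k ^ 2 • mulL2 r u + W) := by
      rw [hv₂, smul_inv_smul₀ (mul_ne_zero ht hμ)]
    rw [smul_sub, smul_comm, h1, h2]
    module
  refine ⟨?_, u₁, u₂, u₃, u₄, W, d01.isWeakDeriv, d12.isWeakDeriv, d23.isWeakDeriv,
    d34.isWeakDeriv, dW.isWeakDeriv.congr_left (coeFn_mulL2 r u₁), ?_⟩
  · let D : ℕ → L2R := fun j => match j with
      | 0 => u
      | 1 => u₁
      | 2 => u₂
      | 3 => u₃
      | _ => u₄
    refine ⟨fun j => D j, rfl, fun j hj => ?_, fun j _ => Lp.memLp (D j)⟩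
    interval_cases j
    exacts [d01.isWeakDeriv, d12.isWeakDeriv, d23.isWeakDeriv, d34.isWeakDeriv]
  · have hlin : (t * μ) • (u₄ - (2 * k ^ 2) • u₂ + k ^ 4 • u) =
        G - t ^ 2 • (k ^ 2 • mulL2 r u - W) := by
      rw [← heq, hu₄, hu₂]
      module
    have hae : (((t * μ) • (u₄ - (2 * k ^ 2) • u₂ + k ^ 4 • u) : L2R) : ℝ → ℝ) =ᵐ[volume]
        ((G - t ^ 2 • (k ^ 2 • mulL2 r u - W) : L2R) : ℝ → ℝ) := by rw [hlin]
    filter_upwards [hae, coeFn_mulL2 r u, coeFn_mulL2 (s * s) u,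
      Lp.coeFn_smul (t * μ) (u₄ - (2 * k ^ 2) • u₂ + k ^ 4 • u),
      Lp.coeFn_add (u₄ - (2 * k ^ 2) • u₂) (k ^ 4 • u), Lp.coeFn_sub u₄ ((2 * k ^ 2) • u₂),
      Lp.coeFn_smul (2 * k ^ 2) u₂, Lp.coeFn_smul (k ^ 4) u,
      Lp.coeFn_sub G (t ^ 2 • (k ^ 2 • mulL2 r u - W)),
      Lp.coeFn_smul (t ^ 2) (k ^ 2 • mulL2 r u - W),
      Lp.coeFn_sub (k ^ 2 • mulL2 r u) W, Lp.coeFn_smul (k ^ 2) (mulL2 r u)]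
      with x h0 h1 h2 h3 h4 h5 h6 h7 h8 h9 h10 h11
    simp only [Pi.add_apply, Pi.sub_apply, Pi.smul_apply, smul_eq_mul] at h3 h4 h5 h6 h7 h8 h9 h10 h11
    rw [h3, h4, h5, h6, h7, h8, h9, h10, h11, h1, h2, BoundedContinuousFunction.mul_apply,
      hs] at h0
    rw [hr']
    linarith

/-- Pair the equation with `v`. Dropping the `φ'` part of the inertia leaves `t μ ‖v‖² + t² k² ∫ ρ
φ² ≤ g k² ∫ ρ' φ² ≤ g m k² ∫ ρ φ²`, and the viscous term makes the inequality strict. -/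
theorem sq_lt_of_pencil {g k μ t m : ℝ} (hk : k ≠ 0) (hμ : 0 < μ) (ht : 0 < t)
    {r r' s : ℝ →ᵇ ℝ} (hr : ∀ x, 0 ≤ r x) (hg : 0 ≤ g) (hm : ∀ x, r' x ≤ m * r x)
    (hs : ∀ x, s x * s x = g * k ^ 2 * r' x) {v : L2R} (hv0 : v ≠ 0)
    (hv : pencilOp (inertiaOp k r) μ t v =
      adjoint (weightedResolvent k s) (weightedResolvent k s v)) : t ^ 2 < g * m := by
  set u := resolventOp k v
  have hE : t * μ * ‖v‖ ^ 2 + t ^ 2 * ⟪inertiaOp k r v, v⟫_ℝ = ⟪mulL2 (s * s) u, u⟫_ℝ := by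
    have h := congrArg (fun w => ⟪w, v⟫_ℝ) hv
    simp only [pencilOp_apply, inner_add_left, real_inner_smul_left, real_inner_self_eq_norm_sq,
      ContinuousLinearMap.adjoint_inner_left] at h
    rw [h, ← mulL2_mulL2, ← inner_mulL2_right]
    exact (real_inner_self_eq_norm_sq _).symm
  have h1 : ⟪mulL2 (s * s) u, u⟫_ℝ ≤ ⟪mulL2 ((g * k ^ 2 * m) • r) u, u⟫_ℝ := by
    refine inner_mulL2_mono (fun x => ?_) u
    rw [BoundedContinuousFunction.mul_apply, hs, BoundedContinuousFunction.smul_apply,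
      smul_eq_mul, mul_assoc _ m]
    exact mul_le_mul_of_nonneg_left (hm x) (by positivity)
  have h2 : ⟪mulL2 ((g * k ^ 2 * m) • r) u, u⟫_ℝ = g * k ^ 2 * m * ⟪mulL2 r u, u⟫_ℝ := by
    rw [inner_mulL2, inner_mulL2, ← integral_const_mul]
    simp only [BoundedContinuousFunction.smul_apply, smul_eq_mul, mul_assoc]
  have h3 : k ^ 2 * ⟪mulL2 r u, u⟫_ℝ ≤ ⟪inertiaOp k r v, v⟫_ℝ := by
    rw [inner_inertiaOp]
    exact le_add_of_nonneg_right (inner_mulL2_nonneg hr _)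
  have h4 : 0 < t * μ * ‖v‖ ^ 2 := by
    have := norm_pos_iff.2 hv0
    positivity
  have h5 : 0 ≤ k ^ 2 * ⟪mulL2 r u, u⟫_ℝ := mul_nonneg (sq_nonneg _) (inner_mulL2_nonneg hr _)
  by_contra! hcon
  have h6 : t ^ 2 * (k ^ 2 * ⟪mulL2 r u, u⟫_ℝ) ≤ t ^ 2 * ⟪inertiaOp k r v, v⟫_ℝ :=
    mul_le_mul_of_nonneg_left h3 (sq_nonneg _)
  have h7 : g * m * (k ^ 2 * ⟪mulL2 r u, u⟫_ℝ) ≤ t ^ 2 * (k ^ 2 * ⟪mulL2 r u, u⟫_ℝ) :=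
    mul_le_mul_of_nonneg_right hcon h5
  rw [h2] at h1
  linarith

theorem exists_Ioc_forall_pos {f : ℝ → ℝ} (hf : Continuous f) {x₀ : ℝ} (hx₀ : 0 < f x₀) :
    ∃ c d, c < d ∧ ∀ x ∈ Ioc c d, 0 < f x := by
  obtain ⟨δ, hδ, h⟩ := Metric.eventually_nhds_iff.1 (hf.continuousAt.eventually (lt_mem_nhds hx₀))
  refine ⟨x₀ - δ / 2, x₀, by linarith, fun x hx => h ?_⟩
  rw [Real.dist_eq, abs_lt]
  constructor <;> linarith [hx.1, hx.2]

end RayleighTaylor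

theorem theorem2p2 (g k μ : ℝ) (hg : 0 < g) (hk : 0 < k) (hμ : 0 < μ)
    (a ρm ρp : ℝ) (hρm : 0 < ρm) (hρ : ρm < ρp)
    (ρ : ℝ → ℝ) (hC1 : ContDiff ℝ 1 ρ) (hmono : ∀ x, 0 ≤ deriv ρ x)
    (hsupp : tsupport (deriv ρ) = Icc (-a) a)
    (hleft : ∀ x ≤ -a, ρ x = ρm) (hright : ∀ x, a ≤ x → ρ x = ρp) :
    ∃ (lam : ℕ → ℝ) (φ : ℕ → ℝ → ℝ),
      (∀ n, lam n ∈ Ioo 0 (Real.sqrt (g / charLength ρ)) ∧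
        MemSobolevH 4 (φ n) ∧
        ¬ (φ n =ᵐ[volume] 0) ∧
        SolvesRayleighTaylorODE g k μ ρ (lam n) (φ n)) ∧
      StrictAnti lam ∧
      Tendsto lam atTop (𝓝 0) := by
  have hdiff : Differentiable ℝ ρ := hC1.differentiable one_ne_zero
  have hρmono : Monotone ρ := monotone_of_deriv_nonneg hdiff hmono
  have hdc : Continuous (deriv ρ) := hC1.continuous_deriv le_rfl
  have hlow : ∀ x, ρm ≤ ρ x := fun x => by
    rw [← hleft (min x (-a)) (min_le_right _ _)]
    exact hρmono (min_le_left _ _)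
  have hup : ∀ x, ρ x ≤ ρp := fun x => by
    rw [← hright (max x a) (le_max_right _ _)]
    exact hρmono (le_max_left _ _)
  have hpos : ∀ x, 0 < ρ x := fun x => hρm.trans_le (hlow x)
  have ha : 0 < a := by
    by_contra! h
    have h1 := hleft 0 (by linarith)
    have h2 := hright 0 h
    linarith
  have hcs : HasCompactSupport (deriv ρ) := by
    rw [HasCompactSupport, hsupp]
    exact isCompact_Icc
  obtain ⟨C, hC⟩ := hcs.exists_bound_of_continuous hdc
  have hbdd : BddAbove (range fun x => deriv ρ x / ρ x) := by
    refine ⟨C / ρm, ?_⟩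
    rintro _ ⟨x, rfl⟩
    have hCx : deriv ρ x ≤ C := (le_abs_self _).trans (hC x)
    exact div_le_div₀ ((hmono x).trans hCx) hCx hρm (hlow x)
  set m := ⨆ x, deriv ρ x / ρ x with hm
  have hle : ∀ x, deriv ρ x ≤ m * ρ x := fun x =>
    (div_le_iff₀ (hpos x)).1 (le_ciSup hbdd x)
  have hchar : g / charLength ρ = g * m := by rw [charLength, div_inv_eq_mul]
  have hzero : ∀ x ∉ Icc (-a) a, deriv ρ x = 0 := fun x hx => by
    rw [← hsupp] at hx
    exact image_eq_zero_of_notMem_tsupport hx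
  obtain ⟨x₀, hx₀⟩ : ∃ x, 0 < deriv ρ x := by
    by_contra! h
    have hd : ∀ x, deriv ρ x = 0 := fun x => le_antisymm (h x) (hmono x)
    have := is_const_of_deriv_eq_zero hdiff hd (-a) a
    rw [hleft _ le_rfl, hright _ le_rfl] at this
    exact hρ.ne this
  obtain ⟨c, d, hcd, hcdpos⟩ := exists_Ioc_forall_pos hdc hx₀
  let r : BoundedContinuousFunction ℝ ℝ :=
    BoundedContinuousFunction.ofNormedAddCommGroup ρ hC1.continuous ρp fun x => by
      rw [Real.norm_of_nonneg (hpos x).le]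
      exact hup x
  let r' : BoundedContinuousFunction ℝ ℝ :=
    BoundedContinuousFunction.ofNormedAddCommGroup (deriv ρ) hdc C hC
  let s : BoundedContinuousFunction ℝ ℝ :=
    BoundedContinuousFunction.ofNormedAddCommGroup (fun x => √(g * k ^ 2 * deriv ρ x))
      (by fun_prop) (√(g * k ^ 2 * C)) fun x => by
        rw [Real.norm_of_nonneg (Real.sqrt_nonneg _)]
        have := (le_abs_self _).trans (hC x)
        gcongr
  have hs : ∀ x, s x * s x = g * k ^ 2 * r' x := fun x =>
    Real.mul_self_sqrt (mul_nonneg (by positivity) (hmono x))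
  have hs0 : ∀ x ∉ Icc (-a) a, s x = 0 := fun x hx => by
    change √(g * k ^ 2 * deriv ρ x) = 0
    rw [hzero x hx, mul_zero, Real.sqrt_zero]
  have hscd : ∀ x ∈ Ioc c d, s x ≠ 0 := fun x hx =>
    (Real.sqrt_pos.2 (mul_pos (by positivity) (hcdpos x hx))).ne'
  let S : Set ℝ := {t | 0 < t ∧ ∃ v : L2R, v ≠ 0 ∧ pencilOp (inertiaOp k r) μ t v =
    ContinuousLinearMap.adjoint (weightedResolvent k s) (weightedResolvent k s v)}
  have hsmall : ∀ ε > 0, ∃ t ∈ S, t < ε := by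
    intro ε hε
    obtain ⟨t, ht, v, hv0, hv⟩ := exists_small_pencil_eigenvalue (isSymmetric_inertiaOp k r)
      (inner_inertiaOp_nonneg k fun x => (hpos x).le) (isCompactOperator_weightedResolvent k ha hs0)
      (exists_finiteDimensional_adjoint_weightedResolvent_injOn hk.ne' hcd hscd) hμ hε
    exact ⟨t, ⟨ht.1, v, hv0, hv⟩, ht.2⟩
  -- An infimum that is not attained is the limit of a strictly decreasing sequence in the set.
  have hglb : IsGLB S 0 := by
    refine ⟨fun t ht => ht.1.le, fun b hb => ?_⟩
    by_contra! hb0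
    obtain ⟨t, ht, htb⟩ := hsmall b hb0
    exact (hb ht).not_gt htb
  have hne : S.Nonempty := by
    obtain ⟨t, ht, _⟩ := hsmall 1 one_pos
    exact ⟨t, ht⟩
  obtain ⟨lam, hanti, -, hlim, hmem⟩ :=
    hglb.exists_seq_strictAnti_tendsto_of_notMem (fun h => lt_irrefl _ h.1) hne
  choose hlam v hv0 hv using hmem
  refine ⟨lam, fun n => resolventOp k (v n), fun n => ?_, hanti, hlim⟩
  obtain ⟨h1, h2⟩ := memSobolevH_and_solves_of_pencil hk.ne' hμ.ne' (hlam n).ne' (r := r) (r' := r')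
    hC1 (fun _ => rfl) hs (hv n)
  refine ⟨⟨hlam n, ?_⟩, h1, fun h0 => hv0 n ?_, h2⟩
  · rw [hchar, Real.lt_sqrt (hlam n).le]
    exact sq_lt_of_pencil hk.ne' hμ (hlam n) (r := r) (r' := r') (fun x => (hpos x).le) hg.le hle
      hs (hv0 n) (hv n)
  · exact resolventOp_injective hk.ne' (Lp.ext (h0.trans (Lp.coeFn_zero ℝ 2 volume).symm))
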